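/- Let $\gamma>0$. Let $\mathcal C^0_b(\mathbb R)$ be the space of bounded continuous real functions on $\mathbb R$, and let $$\mathbb V_\gamma=\{V=|x|^{2\gamma}W \;:\; W\in\mathcal C^0_b(\mathbb R),\ W\ge 1\},$$ regarded as a subset of the vector space $\{|x|^{2\gamma}W : W\in\mathcal C^0_b(\mathbb R)\}$ with the norm $\big\||x|^{2\gamma}W\big\|_{\mathbb V_\gamma}:=\|W\|_\infty$. For $V\in\mathbb V_\gamma$ and $k\in\mathbb Z\setminus\{0\}$, let $P_V^k$ be the unique self-adjoint extension in $L^2(\mathbb R)$ (that is, the closure) of the essentially self-adjoint operator $-\partial_x^2+k^2V$ with domain $\mathcal C_c^\infty(\mathbb R)$. It has compact resolvent; for $n\in\mathbb N$ let $\mathrm{spec}_n(P_V^k)$ denote the set of its first $n$ eigenvalues, listed in increasing order and counted with multiplicity (each of them is in fact simple). For $k,l\in\mathbb Z\setminus\{0\}$ and $n\in\mathbb N$ put $$\mathcal O_{k,l,n}^\gamma=\{V\in\mathbb V_\gamma \;:\; \mathrm{spec}_n(P_V^k)\cap \mathrm{spec}_n(P_V^l)=\emptyset\}.$$ Theorem.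 For every $\gamma>0$, every $n\in\mathbb N$ and all $k,l\in\mathbb Z\setminus\{0\}$ with $k^2\ne l^2$, the set $\mathcal O_{k,l,n}^\gamma$ is open in $(\mathbb V_\gamma,\|\cdot\|_{\mathbb V_\gamma})$. -/

import Mathlib

open MeasureTheory BoundedContinuousFunction
open scoped ContDiff ENNReal

noncomputable section

namespace Grushin

/-! ### The weighted space and the potentials -/

/-- The linear map `W ↦ |x|^(2γ) W` on bounded continuous functions. -/
def weightMul (γ : ℝ) : (ℝ →ᵇ ℝ) →ₗ[ℝ] (ℝ → ℝ) where
  toFun W := fun x => |x| ^ (2 * γ) * W x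
  map_add' W₁ W₂ := by
    funext x
    simp [mul_add]
  map_smul' c W := by
    funext x
    simp [mul_left_comm]

theorem weightMul_injective (γ : ℝ) : Function.Injective (weightMul γ) := by
  intro W₁ W₂ h
  have hd : Dense ({0}ᶜ : Set ℝ) := dense_compl_singleton 0
  have : (W₁ : ℝ → ℝ) = W₂ := by
    refine Continuous.ext_on hd W₁.continuous W₂.continuous ?_
    intro x hx
    have hx0 : x ≠ 0 := hx
    have h1 : |x| ^ (2 * γ) * W₁ x = |x| ^ (2 * γ) * W₂ x := congrFun h x
    exact mul_left_cancel₀ (Real.rpow_pos_of_pos (abs_pos.mpr hx0) _).ne' h1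
  exact DFunLike.coe_injective this

/-- The vector space `{|x|^(2γ) W : W bounded continuous}` of functions on the line (as its own
type, so that it carries the norm below and not the topology of pointwise convergence). -/
def WeightedSpace (γ : ℝ) : Type := ↥(LinearMap.range (weightMul γ))

instance (γ : ℝ) : AddCommGroup (WeightedSpace γ) :=
  inferInstanceAs (AddCommGroup ↥(LinearMap.range (weightMul γ)))

instance (γ : ℝ) : Module ℝ (WeightedSpace γ) :=
  inferInstanceAs (Module ℝ ↥(LinearMap.range (weightMul γ)))

instance (γ : ℝ) : CoeFun (WeightedSpace γ) (fun _ => ℝ → ℝ) := ⟨fun V => V.1⟩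

/-- `W ↦ |x|^(2γ) W` as a linear bijection onto the weighted space. -/
def weightEquiv (γ : ℝ) : (ℝ →ᵇ ℝ) ≃ₗ[ℝ] WeightedSpace γ :=
  LinearEquiv.ofInjective (weightMul γ) (weightMul_injective γ)

/-- The norm of `V = |x|^(2γ) W` is the sup norm of `W`. -/
instance (γ : ℝ) : NormedAddCommGroup (WeightedSpace γ) :=
  NormedAddCommGroup.induced (WeightedSpace γ) (ℝ →ᵇ ℝ) (weightEquiv γ).symm
    (weightEquiv γ).symm.injective

theorem weightEquiv_apply (γ : ℝ) (W : ℝ →ᵇ ℝ) (x : ℝ) :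
    weightEquiv γ W x = |x| ^ (2 * γ) * W x := rfl

theorem norm_weightEquiv (γ : ℝ) (W : ℝ →ᵇ ℝ) : ‖weightEquiv γ W‖ = ‖W‖ := by
  change ‖(weightEquiv γ).symm (weightEquiv γ W)‖ = ‖W‖
  rw [LinearEquiv.symm_apply_apply]

/-- The set of potentials `V = |x|^(2γ) W` with `W` bounded, continuous and `W ≥ 1`. -/
def potentials (γ : ℝ) : Set (WeightedSpace γ) :=
  {V | ∃ W : ℝ →ᵇ ℝ, (∀ x, 1 ≤ W x) ∧ ∀ x, V x = |x| ^ (2 * γ) * W x}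

/-! ### The one-dimensional Schrödinger operator -/

/-- The Hilbert space `L²(ℝ)`. -/
abbrev L2 : Type := Lp ℂ 2 (volume : Measure ℝ)

/-- The graph of `-∂ₓ² + k² V` on the smooth compactly supported functions. -/
def testGraph (V : ℝ → ℝ) (k : ℤ) : Submodule ℂ (L2 × L2) where
  carrier := {p | ∃ φ : ℝ → ℂ, ContDiff ℝ ∞ φ ∧ HasCompactSupport φ ∧
    p.1 =ᵐ[volume] φ ∧
    p.2 =ᵐ[volume] fun x => -deriv (deriv φ) x + (k : ℂ) ^ 2 * (V x : ℂ) * φ x}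
  zero_mem' := by
    refine ⟨fun _ => 0, contDiff_const, HasCompactSupport.zero, ?_, ?_⟩
    · exact Lp.coeFn_zero ℂ 2 volume
    · filter_upwards with x
      simp
  add_mem' := by
    rintro p q ⟨φ, hφ, hcφ, hp1, hp2⟩ ⟨ψ, hψ, hcψ, hq1, hq2⟩
    have d1 : ∀ {f : ℝ → ℂ}, ContDiff ℝ ∞ f → Differentiable ℝ f :=
      fun hf => hf.differentiable (by simp)
    have d2 : ∀ {f : ℝ → ℂ}, ContDiff ℝ ∞ f → Differentiable ℝ (deriv f) := fun hf =>
      (contDiff_infty_iff_deriv.1 hf).2.differentiable (by simp)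
    refine ⟨φ + ψ, hφ.add hψ, hcφ.add hcψ, ?_, ?_⟩
    · exact (Lp.coeFn_add p.1 q.1).trans (hp1.add hq1)
    · have e : deriv (φ + ψ) = deriv φ + deriv ψ := by
        funext x
        exact deriv_add (d1 hφ x) (d1 hψ x)
      have e2 : ∀ x, deriv (deriv (φ + ψ)) x = deriv (deriv φ) x + deriv (deriv ψ) x := by
        intro x
        rw [e]
        exact deriv_add (d2 hφ x) (d2 hψ x)
      filter_upwards [Lp.coeFn_add p.2 q.2, hp2, hq2] with x hx h1 h2
      change (p.2 + q.2 : L2) x = _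
      rw [hx, Pi.add_apply, h1, h2, e2, Pi.add_apply]
      ring
  smul_mem' := by
    rintro c p ⟨φ, hφ, hcφ, hp1, hp2⟩
    refine ⟨c • φ, contDiff_const.smul hφ, hcφ.smul_left (f := fun _ => c), ?_, ?_⟩
    · exact (Lp.coeFn_smul c p.1).trans (hp1.const_smul c)
    · have e : deriv (c • φ) = c • deriv φ := by
        funext x
        exact deriv_const_smul_field c φ
      have e2 : ∀ x, deriv (deriv (c • φ)) x = c * deriv (deriv φ) x := by
        intro x
        rw [e]
        exact deriv_const_smul_field c (deriv φ)
      filter_upwards [Lp.coeFn_smul c p.2, hp2] with x hx h1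
      change (c • p.2 : L2) x = _
      rw [hx, Pi.smul_apply, h1, e2, Pi.smul_apply, smul_eq_mul, smul_eq_mul]
      ring

/-- The graph above is single valued, so it is the graph of a partial linear map. -/
theorem testGraph_fst_eq_zero (V : ℝ → ℝ) (k : ℤ) (p : L2 × L2) (hp : p ∈ testGraph V k)
    (h0 : p.1 = 0) : p.2 = 0 := by
  obtain ⟨φ, hφ, -, h1, h2⟩ := hp
  have hz : φ =ᵐ[volume] (0 : ℝ → ℂ) := by
    rw [h0] at h1
    exact h1.symm.trans (Lp.coeFn_zero ℂ 2 volume)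
  have hφ0 : φ = 0 := (Continuous.ae_eq_iff_eq volume hφ.continuous continuous_zero).1 hz
  subst hφ0
  refine Lp.ext (h2.trans ?_)
  filter_upwards [Lp.coeFn_zero ℂ 2 (volume : Measure ℝ)] with x hx
  rw [hx]
  have e : deriv (0 : ℝ → ℂ) = 0 := by
    funext y
    exact deriv_const y (0 : ℂ)
  simp [e]

/-- The operator `-∂ₓ² + k² V` in `L²(ℝ)` with domain the smooth compactly supported functions. -/
def minimalOperator (V : ℝ → ℝ) (k : ℤ) : L2 →ₗ.[ℂ] L2 :=
  (testGraph V k).toLinearPMap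

theorem minimalOperator_graph (V : ℝ → ℝ) (k : ℤ) :
    (minimalOperator V k).graph = testGraph V k :=
  Submodule.toLinearPMap_graph_eq _ (testGraph_fst_eq_zero V k)

/-- The operator `P_V^k`: the closure of `-∂ₓ² + k² V` on the smooth compactly supported functions
(the only self-adjoint extension of that operator, as it is essentially self-adjoint). -/
def schrodinger (V : ℝ → ℝ) (k : ℤ) : L2 →ₗ.[ℂ] L2 :=
  (minimalOperator V k).closure

/-! ### Eigenvalues -/

/-- The eigenspace `{u ∈ dom A : A u = lam u}` of an operator `A` in `L²(ℝ)`. -/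
def eigenspace (A : L2 →ₗ.[ℂ] L2) (lam : ℝ) : Submodule ℂ L2 :=
  (LinearMap.ker (A.toFun - (lam : ℂ) • A.domain.subtype)).map A.domain.subtype

theorem mem_eigenspace (A : L2 →ₗ.[ℂ] L2) (lam : ℝ) (u : L2) :
    u ∈ eigenspace A lam ↔ ∃ h : u ∈ A.domain, A ⟨u, h⟩ = (lam : ℂ) • u := by
  constructor
  · rintro ⟨v, hv, rfl⟩
    exact ⟨v.2, sub_eq_zero.1 hv⟩
  · rintro ⟨h, hu⟩
    exact ⟨⟨u, h⟩, sub_eq_zero.2 hu, rfl⟩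

/-- The set of the first `n` eigenvalues `lam₁ ≤ lam₂ ≤ … ≤ lamₙ`, counted with multiplicity, of a
symmetric operator: an eigenvalue is one of them exactly when fewer than `n` eigenvalues, counted
with multiplicity, lie strictly below it. -/
def firstEigenvalues (A : L2 →ₗ.[ℂ] L2) (n : ℕ) : Set ℝ :=
  {lam | eigenspace A lam ≠ ⊥ ∧
    Module.rank ℂ ↥(⨆ μ : {μ : ℝ // μ < lam}, eigenspace A μ) < n}

/-- The set of the potentials `V` for which no number is both among the first `n` eigenvalues of
`P_V^k` and among the first `n` eigenvalues of `P_V^l`. -/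
def goodSet (γ : ℝ) (k l : ℤ) (n : ℕ) : Set ↥(potentials γ) :=
  {V | firstEigenvalues (schrodinger V.1 k) n ∩ firstEigenvalues (schrodinger V.1 l) n = ∅}

end Grushin

end

/-!
The operators are studied through their resolvents `R_V = (P_V^k + 1)⁻¹`. Each `R_V` is a positive,
injective, compact self-adjoint operator on `L²(ℝ)`, and `lam ↦ (1 + lam)⁻¹` carries the first `n`
eigenvalues of `P_V^k` to the `n` largest eigenvalues of `R_V` (`mem_firstEigenvalues_iff`).

The resolvent depends on the potential in a Lipschitz way, `‖R_V - R_V'‖ ≤ ‖V - V'‖`. For test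
functions `φ`, `ψ` one has
`⟪φ, (P_V' + 1) ψ⟫ - ⟪(P_V + 1) φ, ψ⟫ = k² ∫ (V' - V) conj φ ψ`, and
`|V' - V| ≤ ‖V - V'‖ |x|^(2γ) ≤ ‖V - V'‖ √V √V'`, while `k² ∫ V |φ|² ≤ ‖(P_V + 1) φ‖²`
(`norm_form_sub_le`, `IsResolvent.norm_sub_le`).

The set of the `n` largest eigenvalues is upper semicontinuous in the operator norm among compact
self-adjoint operators (`mem_topEigenvalues_of_tendsto`): limits of eigenvalues are eigenvalues,
because `T - μ` is bounded below for `μ ≠ 0` not an eigenvalue of `T`, and the number of larger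
eigenvalues is controlled by the min-max principle. For a positive injective operator on an
infinite-dimensional space these eigenvalues also stay away from `0`
(`exists_lt_topEigenvalues`). Disjointness of two such sets is therefore an open condition.

Two facts of analysis on the line enter. The range of `P_V^k + 1` on the test functions is dense
(`dense_range_testGraph`), because an `L²` solution `g` of `g'' = (k² V + 1) g` is classical, so
that its square is convex and integrable, hence zero. The resolvent is compact
(`exists_finiteDimensional_approx`), because functions of bounded energy are uniformly close to
step functions on a fixed finite set of cells.
-/

namespace Grushin

/-! ### Eigenvalues of compact self-adjoint operators and the min-max principle -/

section Abstract

open Module.End Filter Topology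
open scoped InnerProductSpace

variable {H : Type*} [NormedAddCommGroup H] [InnerProductSpace ℂ H]

/-- The algebraic span of the eigenvectors of `T` with real eigenvalue strictly above `t`. -/
def eigenspacesAbove (T : H →L[ℂ] H) (t : ℝ) : Submodule ℂ H :=
  ⨆ s : {s : ℝ // t < s}, Module.End.eigenspace (T : H →ₗ[ℂ] H) ((s : ℝ) : ℂ)

/-- The first `n` positive eigenvalues of `T` in decreasing order, counted with multiplicity. -/
def topEigenvalues (T : H →L[ℂ] H) (n : ℕ) : Set ℝ :=
  {t | 0 < t ∧ Module.End.eigenspace (T : H →ₗ[ℂ] H) (t : ℂ) ≠ ⊥ ∧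
    Module.rank ℂ ↥(eigenspacesAbove T t) < n}

theorem eigenspace_le_eigenspacesAbove (T : H →L[ℂ] H) {t s : ℝ} (h : t < s) :
    Module.End.eigenspace (T : H →ₗ[ℂ] H) (s : ℂ) ≤ eigenspacesAbove T t :=
  le_iSup (fun s : {s : ℝ // t < s} => Module.End.eigenspace (T : H →ₗ[ℂ] H) ((s : ℝ) : ℂ)) ⟨s, h⟩

theorem map_mem_orthogonal_eigenspacesAbove {T : H →L[ℂ] H}
    (hs : (T : H →ₗ[ℂ] H).IsSymmetric) {t : ℝ} {u : H} (hu : u ∈ (eigenspacesAbove T t)ᗮ) :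
    T u ∈ (eigenspacesAbove T t)ᗮ := by
  rw [eigenspacesAbove, ← Submodule.iInf_orthogonal, Submodule.mem_iInf] at hu ⊢
  intro s
  rw [Submodule.mem_orthogonal]
  intro w hw
  have h1 : T w = ((s : ℝ) : ℂ) • w := Module.End.mem_eigenspace_iff.1 hw
  have h2 := hs w u
  simp only [ContinuousLinearMap.coe_coe] at h2
  rw [← h2, h1, inner_smul_left, (Submodule.mem_orthogonal _ _).1 (hu s) w hw, mul_zero]

/-- A compact self-adjoint operator all of whose real eigenvalues are at most `t ≥ 0` is bounded
above by `t`, since its nonzero spectral values are eigenvalues. -/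
theorem re_inner_le_of_eigenvalues_le [CompleteSpace H] {T : H →L[ℂ] H} (hc : IsCompactOperator T)
    (hs : (T : H →ₗ[ℂ] H).IsSymmetric) {t : ℝ} (ht : 0 ≤ t)
    (h : ∀ r : ℝ, Module.End.HasEigenvalue (T : H →ₗ[ℂ] H) (r : ℂ) → r ≤ t) (u : H) :
    (⟪T u, u⟫_ℂ).re ≤ t * ‖u‖ ^ 2 := by
  have hle : T ≤ algebraMap ℝ _ t := by
    have hsa : IsSelfAdjoint T := ContinuousLinearMap.isSelfAdjoint_iff_isSymmetric.2 hs
    refine le_algebraMap_of_spectrum_le (fun r hr => ?_) hsa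
    by_contra! hlt
    have hr' : (r : ℂ) ∈ spectrum ℂ T := by
      simpa using (spectrum.algebraMap_mem ℂ hr)
    have hr0 : (r : ℂ) ≠ 0 := by
      exact_mod_cast (lt_of_le_of_lt ht hlt).ne'
    exact absurd (h r ((hc.hasEigenvalue_iff_mem_spectrum hr0).2 hr')) (not_le.2 hlt)
  have hp := ((ContinuousLinearMap.le_def _ _).1 hle).re_inner_nonneg_left u
  have e : (algebraMap ℝ (H →L[ℂ] H) t) u = (t : ℂ) • u := by
    rw [Algebra.algebraMap_eq_smul_one]
    simp
  have e4 : ((starRingEnd ℂ) (t : ℂ) * ((‖u‖ : ℝ) : ℂ) ^ 2) = ((t * ‖u‖ ^ 2 : ℝ) : ℂ) := by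
    rw [Complex.conj_ofReal]; push_cast; ring
  rw [_root_.sub_apply, e, inner_sub_left, inner_smul_left, inner_self_eq_norm_sq_to_K] at hp
  simp only [Complex.coe_algebraMap, RCLike.re_to_complex] at hp
  rw [e4, Complex.sub_re, Complex.ofReal_re] at hp
  linarith

/-- On the orthogonal complement of the eigenvectors above `t`, the quadratic form is at most `t`:
that space is invariant, and no eigenvalue of the restriction exceeds `t`. -/
theorem re_inner_le_of_mem_orthogonal [CompleteSpace H] {T : H →L[ℂ] H} (hc : IsCompactOperator T)
    (hs : (T : H →ₗ[ℂ] H).IsSymmetric) {t : ℝ} (ht : 0 ≤ t) {u : H}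
    (hu : u ∈ (eigenspacesAbove T t)ᗮ) : (⟪T u, u⟫_ℂ).re ≤ t * ‖u‖ ^ 2 := by
  have hinv : ∀ v ∈ (eigenspacesAbove T t)ᗮ, T v ∈ (eigenspacesAbove T t)ᗮ :=
    fun v hv => map_mem_orthogonal_eigenspacesAbove hs hv
  refine re_inner_le_of_eigenvalues_le (T := T.restrict hinv) (hc.restrict' hinv)
    (hs.restrict_invariant hinv) ht (fun r hr => ?_) ⟨u, hu⟩
  by_contra! hlt
  obtain ⟨v, hv⟩ := hr.exists_hasEigenvector
  have h2 : T (v : H) = (r : ℂ) • (v : H) := congrArg Subtype.val hv.apply_eq_smul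
  have h3 : (v : H) ∈ eigenspacesAbove T t :=
    eigenspace_le_eigenspacesAbove T hlt (Module.End.mem_eigenspace_iff.2 h2)
  have h4 : ⟪(v : H), v⟫_ℂ = 0 := (Submodule.mem_orthogonal _ _).1 v.2 _ h3
  exact hv.2 (Subtype.ext (inner_self_eq_zero.1 h4))

/-- Half of the min-max principle: if the quadratic form of `T` is at least `c` on an
`n`-dimensional space, then `T` has at least `n` eigenvalues above any `t ∈ [0, c)`. -/
theorem le_rank_eigenspacesAbove [CompleteSpace H] {T : H →L[ℂ] H} (hc : IsCompactOperator T)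
    (hs : (T : H →ₗ[ℂ] H).IsSymmetric) {t c : ℝ} (ht : 0 ≤ t) (htc : t < c) {n : ℕ}
    (E : Submodule ℂ H) (hn : (n : Cardinal) ≤ Module.rank ℂ E)
    (hE : ∀ u ∈ E, c * ‖u‖ ^ 2 ≤ (⟪T u, u⟫_ℂ).re) :
    (n : Cardinal) ≤ Module.rank ℂ ↥(eigenspacesAbove T t) := by
  by_contra! hlt
  have hfin : FiniteDimensional ℂ ↥(eigenspacesAbove T t) :=
    Module.rank_lt_aleph0_iff.1 (hlt.trans (Cardinal.natCast_lt_aleph0))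
  let P : E →ₗ[ℂ] ↥(eigenspacesAbove T t) :=
    ((eigenspacesAbove T t).orthogonalProjectionOnto : H →ₗ[ℂ] _).comp E.subtype
  have hP : ¬ Function.Injective P := fun hinj =>
    absurd (LinearMap.rank_le_of_injective P hinj) (not_le.2 (hlt.trans_le hn))
  rw [← LinearMap.ker_eq_bot, Submodule.eq_bot_iff] at hP
  push Not at hP
  obtain ⟨u, hu, hu0⟩ := hP
  have hu' : (u : H) ∈ (eigenspacesAbove T t)ᗮ := by
    rw [← Submodule.orthogonalProjectionOnto_eq_zero_iff]
    exact hu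
  have h1 := re_inner_le_of_mem_orthogonal hc hs ht hu'
  have h2 := hE u u.2
  have h3 : 0 < ‖(u : H)‖ ^ 2 := by
    have : (u : H) ≠ 0 := fun h => hu0 (Subtype.ext h)
    positivity
  nlinarith

/-- On the span of the eigenvectors with eigenvalue at least `c`, the quadratic form is at least
`c`. -/
theorem mul_norm_sq_le_re_inner_of_mem_iSup {T : H →L[ℂ] H}
    (hs : (T : H →ₗ[ℂ] H).IsSymmetric) {c : ℝ} {u : H}
    (hu : u ∈ ⨆ s : {s : ℝ // c ≤ s}, Module.End.eigenspace (T : H →ₗ[ℂ] H) ((s : ℝ) : ℂ)) :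
    c * ‖u‖ ^ 2 ≤ (⟪T u, u⟫_ℂ).re := by
  classical
  obtain ⟨f, hf, hsum⟩ := (Submodule.mem_iSup_iff_exists_finsupp _ _).1 hu
  have hV : OrthogonalFamily ℂ
      (fun s : {s : ℝ // c ≤ s} => Module.End.eigenspace (T : H →ₗ[ℂ] H) ((s : ℝ) : ℂ))
      fun s => (Module.End.eigenspace (T : H →ₗ[ℂ] H) ((s : ℝ) : ℂ)).subtypeₗᵢ :=
    hs.orthogonalFamily_eigenspaces.comp (γ := {s : ℝ // c ≤ s}) (f := fun s => ((s : ℝ) : ℂ))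
      (fun a b h => Subtype.ext (Complex.ofReal_injective h))
  have h1 := hV.inner_sum
    (fun s => (⟨f s, hf s⟩ : Module.End.eigenspace (T : H →ₗ[ℂ] H) ((s : ℝ) : ℂ)))
    (fun s => ⟨f s, hf s⟩) f.support
  have h2 := hV.inner_sum (fun s => ((s : ℝ) : ℂ) •
      (⟨f s, hf s⟩ : Module.End.eigenspace (T : H →ₗ[ℂ] H) ((s : ℝ) : ℂ)))
    (fun s => ⟨f s, hf s⟩) f.support
  simp only [Submodule.coe_subtypeₗᵢ, Submodule.subtype_apply, Submodule.coe_smul,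
    Submodule.coe_inner] at h1 h2
  have hu1 : u = ∑ s ∈ f.support, f s := hsum.symm
  have hu2 : T u = ∑ s ∈ f.support, ((s : ℝ) : ℂ) • f s := by
    rw [hu1, map_sum]
    exact Finset.sum_congr rfl fun s _ => Module.End.mem_eigenspace_iff.1 (hf s)
  rw [← hu1] at h1 h2
  rw [← hu2] at h2
  have h3 : ‖u‖ ^ 2 = ∑ s ∈ f.support, ‖f s‖ ^ 2 := by
    have := congrArg Complex.re h1
    rw [Complex.re_sum] at this
    simpa [inner_self_eq_norm_sq_to_K, ← Complex.ofReal_pow] using this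
  have h4 : (⟪T u, u⟫_ℂ).re = ∑ s ∈ f.support, (s : ℝ) * ‖f s‖ ^ 2 := by
    rw [h2, Complex.re_sum]
    refine Finset.sum_congr rfl fun s _ => ?_
    rw [inner_smul_left, inner_self_eq_norm_sq_to_K]
    simp [← Complex.ofReal_pow]
  rw [h3, h4, Finset.mul_sum]
  exact Finset.sum_le_sum fun s _ => mul_le_mul_of_nonneg_right s.2 (by positivity)

/-- The other half of the min-max principle, with strict inequality: `n` eigenvalues above `t`
give an `n`-dimensional space on which the quadratic form is at least some `c > t`. -/
theorem exists_submodule_of_le_rank_eigenspacesAbove {T : H →L[ℂ] H}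
    (hs : (T : H →ₗ[ℂ] H).IsSymmetric) {t : ℝ} {n : ℕ}
    (hn : (n : Cardinal) ≤ Module.rank ℂ ↥(eigenspacesAbove T t)) :
    ∃ E : Submodule ℂ H, (n : Cardinal) ≤ Module.rank ℂ E ∧
      ∃ c > t, ∀ u ∈ E, c * ‖u‖ ^ 2 ≤ (⟪T u, u⟫_ℂ).re := by
  classical
  obtain ⟨b, hb, hli⟩ := le_rank_iff_exists_linearIndependent_finset.1 hn
  have hmem : ∀ x : ↥(eigenspacesAbove T t), ∀ᶠ c in 𝓝[>] t, (x : H) ∈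
      ⨆ s : {s : ℝ // c ≤ s}, Module.End.eigenspace (T : H →ₗ[ℂ] H) ((s : ℝ) : ℂ) := by
    intro x
    obtain ⟨F, hF⟩ := Submodule.mem_iSup_iff_exists_finset.1 x.2
    have h1 : ∀ᶠ c in 𝓝[>] t, ∀ s ∈ F, c ≤ (s : ℝ) := by
      rw [Filter.eventually_all_finset]
      intro s _
      filter_upwards [Ioo_mem_nhdsGT s.2] with c hc using hc.2.le
    filter_upwards [h1] with c hc
    refine SetLike.le_def.1 (iSup₂_le fun s hs => ?_) hF
    exact le_iSup (fun s : {s : ℝ // c ≤ s} =>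
      Module.End.eigenspace (T : H →ₗ[ℂ] H) ((s : ℝ) : ℂ)) ⟨s, hc s hs⟩
  have hall : ∀ᶠ c in 𝓝[>] t, ∀ x ∈ b, (x : H) ∈
      ⨆ s : {s : ℝ // c ≤ s}, Module.End.eigenspace (T : H →ₗ[ℂ] H) ((s : ℝ) : ℂ) := by
    rw [Filter.eventually_all_finset]
    exact fun x _ => hmem x
  obtain ⟨c, hcb, hct⟩ := (hall.and self_mem_nhdsWithin).exists
  refine ⟨_, ?_, c, hct, fun u hu => mul_norm_sq_le_re_inner_of_mem_iSup hs hu⟩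
  rw [← hb]
  let g : b → ↥(⨆ s : {s : ℝ // c ≤ s}, Module.End.eigenspace (T : H →ₗ[ℂ] H) ((s : ℝ) : ℂ)) :=
    fun x => ⟨(x : ↥(eigenspacesAbove T t)), hcb x x.2⟩
  have hg : LinearIndependent ℂ g := by
    refine LinearIndependent.of_comp (Submodule.subtype _) ?_
    exact hli.map' (eigenspacesAbove T t).subtype (Submodule.ker_subtype _)
  simpa using hg.cardinal_le_rank

theorem sub_mul_le_re_inner {T₀ : H →L[ℂ] H} {c : ℝ} {u : H}
    (h : c * ‖u‖ ^ 2 ≤ (⟪T₀ u, u⟫_ℂ).re) (T : H →L[ℂ] H) :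
    (c - ‖T₀ - T‖) * ‖u‖ ^ 2 ≤ (⟪T u, u⟫_ℂ).re := by
  have h1 : (⟪T₀ u, u⟫_ℂ).re - (⟪T u, u⟫_ℂ).re ≤ ‖T₀ - T‖ * ‖u‖ ^ 2 := by
    rw [← Complex.sub_re, ← inner_sub_left, ← _root_.sub_apply]
    refine (Complex.re_le_norm _).trans ((norm_inner_le_norm _ _).trans ?_)
    rw [sq, ← mul_assoc]
    gcongr
    exact ContinuousLinearMap.le_opNorm _ _
  linarith

/-- Upper semicontinuity of the set of the first `n` eigenvalues, for eigenvalues that do not tend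
to `0`. -/
theorem mem_topEigenvalues_of_tendsto [CompleteSpace H] {ι : Type*} {l : Filter ι} [l.NeBot]
    {T : ι → H →L[ℂ] H} {T₀ : H →L[ℂ] H} {t : ι → ℝ} {t₀ : ℝ} {n : ℕ}
    (hc : ∀ i, IsCompactOperator (T i)) (hs : ∀ i, (T i : H →ₗ[ℂ] H).IsSymmetric)
    (hc₀ : IsCompactOperator T₀) (hs₀ : (T₀ : H →ₗ[ℂ] H).IsSymmetric)
    (hT : Tendsto T l (𝓝 T₀)) (ht : Tendsto t l (𝓝 t₀)) (ht₀ : 0 < t₀)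
    (h : ∀ i, t i ∈ topEigenvalues (T i) n) : t₀ ∈ topEigenvalues T₀ n := by
  have hT' : Tendsto (fun i => ‖T₀ - T i‖) l (𝓝 0) := by
    simpa using ((tendsto_const_nhds (x := T₀)).sub hT).norm
  refine ⟨ht₀, ?_, ?_⟩
  · -- Otherwise `T₀ - t₀` is bounded below, which the unit eigenvectors of `T i` contradict.
    intro hbot
    obtain ⟨K, hK⟩ := hc₀.antilipschitz_of_not_hasEigenvalue (μ := (t₀ : ℂ))
      (by exact_mod_cast ht₀.ne') (by rw [Module.End.hasEigenvalue_iff]; exact not_not.2 hbot)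
    have hlim : Tendsto (fun i => (K : ℝ) * (‖T₀ - T i‖ + |t i - t₀|)) l (𝓝 0) := by
      have : Tendsto (fun i => |t i - t₀|) l (𝓝 0) := by
        simpa using (ht.sub_const t₀).abs
      simpa using (hT'.add this).const_mul (K : ℝ)
    obtain ⟨i, hi⟩ := (hlim.eventually (gt_mem_nhds one_pos)).exists
    obtain ⟨u, hu, hu0⟩ := (Submodule.ne_bot_iff _).1 (h i).2.1
    have hu1 : T i u = (t i : ℂ) • u := Module.End.mem_eigenspace_iff.1 hu
    have h1 : (T₀ - (t₀ : ℂ) • (1 : H →L[ℂ] H)) u = (T₀ - T i) u + ((t i - t₀ : ℝ) : ℂ) • u := by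
      have e : (T₀ - (t₀ : ℂ) • (1 : H →L[ℂ] H)) u = T₀ u - (t₀ : ℂ) • u := rfl
      rw [e, _root_.sub_apply, hu1]
      push_cast
      module
    have h2 := hK.le_mul_norm (f := (T₀ - (t₀ : ℂ) • (1 : H →L[ℂ] H))) (map_zero _) u
    have h3 : ‖(T₀ - T i) u + ((t i - t₀ : ℝ) : ℂ) • u‖ ≤ (‖T₀ - T i‖ + |t i - t₀|) * ‖u‖ := by
      refine (norm_add_le _ _).trans ?_
      rw [norm_smul, Complex.norm_real, Real.norm_eq_abs, add_mul]
      gcongr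
      exact ContinuousLinearMap.le_opNorm _ _
    rw [h1] at h2
    have h4 : 0 < ‖u‖ := norm_pos_iff.2 hu0
    have h5 : ‖u‖ ≤ (K : ℝ) * (‖T₀ - T i‖ + |t i - t₀|) * ‖u‖ := by
      rw [mul_assoc]
      exact h2.trans (mul_le_mul_of_nonneg_left h3 K.2)
    nlinarith
  · by_contra! hn
    obtain ⟨E, hE, c, hct, hEc⟩ := exists_submodule_of_le_rank_eigenspacesAbove hs₀ hn
    have hlim : Tendsto (fun i => t i + ‖T₀ - T i‖) l (𝓝 t₀) := by
      simpa using ht.add hT'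
    obtain ⟨i, hi⟩ := (hlim.eventually (gt_mem_nhds hct)).exists
    exact absurd (h i).2.2 (not_lt.2 (le_rank_eigenspacesAbove (hc i) (hs i) (h i).1.le
      (lt_sub_iff_add_lt.2 hi) E hE fun u hu => sub_mul_le_re_inner (hEc u hu) (T i)))

/-- The first `n` positive eigenvalues of a positive injective compact operator are bounded away
from `0`, uniformly on a neighbourhood of the operator. -/
theorem exists_lt_topEigenvalues [CompleteSpace H] {T₀ : H →L[ℂ] H} (hH : ¬ FiniteDimensional ℂ H)
    (hc₀ : IsCompactOperator T₀) (hs₀ : (T₀ : H →ₗ[ℂ] H).IsSymmetric)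
    (hpos : ∀ u, 0 ≤ (⟪T₀ u, u⟫_ℂ).re) (hinj : ∀ u, T₀ u = 0 → u = 0) (n : ℕ) :
    ∃ c > 0, ∀ T : H →L[ℂ] H, IsCompactOperator T → (T : H →ₗ[ℂ] H).IsSymmetric →
      ‖T₀ - T‖ < c → ∀ t ∈ topEigenvalues T n, c ≤ t := by
  have htop : (⨆ μ, Module.End.eigenspace (T₀ : H →ₗ[ℂ] H) μ) ≤ eigenspacesAbove T₀ 0 := by
    refine iSup_le fun μ u hu => ?_
    by_cases hu0 : u = 0
    · rw [hu0]; exact Submodule.zero_mem _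
    have hev : Module.End.HasEigenvalue (T₀ : H →ₗ[ℂ] H) μ :=
      Module.End.hasEigenvalue_of_hasEigenvector ⟨hu, hu0⟩
    have hμ : ((μ.re : ℝ) : ℂ) = μ := Complex.conj_eq_iff_re.1 (hs₀.conj_eigenvalue_eq_self hev)
    have hu1 : T₀ u = (μ.re : ℂ) • u := by rw [hμ]; exact Module.End.mem_eigenspace_iff.1 hu
    have h1 : 0 < ‖u‖ ^ 2 := by positivity
    have h2 : 0 ≤ μ.re * ‖u‖ ^ 2 := by
      have := hpos u
      rw [hu1, inner_smul_left, inner_self_eq_norm_sq_to_K, Complex.conj_ofReal] at this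
      simpa [← Complex.ofReal_pow] using this
    have h3 : μ.re ≠ 0 := by
      intro h
      rw [h] at hu1
      exact hu0 (hinj u (by simpa using hu1))
    have h4 : 0 < μ.re := lt_of_le_of_ne (nonneg_of_mul_nonneg_left h2 h1) h3.symm
    refine eigenspace_le_eigenspacesAbove T₀ h4 ?_
    rw [hμ]
    exact hu
  have hn : (n : Cardinal) ≤ Module.rank ℂ ↥(eigenspacesAbove T₀ 0) := by
    by_contra! hlt
    have hfin : FiniteDimensional ℂ ↥(eigenspacesAbove T₀ 0) :=
      Module.rank_lt_aleph0_iff.1 (hlt.trans (Cardinal.natCast_lt_aleph0))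
    have h1 : (eigenspacesAbove T₀ 0)ᗮ = ⊥ := by
      rw [eq_bot_iff, ← ContinuousLinearMap.orthogonalComplement_iSup_eigenspaces_eq_bot hc₀ hs₀]
      exact Submodule.orthogonal_le htop
    rw [Submodule.orthogonal_eq_bot_iff] at h1
    rw [h1] at hfin
    exact hH (Module.Finite.equiv (Submodule.topEquiv (R := ℂ) (M := H)))
  obtain ⟨E, hE, c, hc, hEc⟩ := exists_submodule_of_le_rank_eigenspacesAbove hs₀ hn
  refine ⟨c / 2, half_pos hc, fun T hcT hsT hT t ht => ?_⟩
  by_contra! hlt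
  exact absurd ht.2.2 (not_lt.2 (le_rank_eigenspacesAbove hcT hsT ht.1.le
    (by linarith : t < c - ‖T₀ - T‖) E hE fun u hu => sub_mul_le_re_inner (hEc u hu) T))

theorem le_norm_of_mem_topEigenvalues {T : H →L[ℂ] H} {t : ℝ} {n : ℕ}
    (ht : t ∈ topEigenvalues T n) : t ≤ ‖T‖ := by
  obtain ⟨u, hu, hu0⟩ := (Submodule.ne_bot_iff _).1 ht.2.1
  have hu1 : T u = (t : ℂ) • u := Module.End.mem_eigenspace_iff.1 hu
  have h := T.le_opNorm u
  rw [hu1, norm_smul, Complex.norm_real, Real.norm_eq_abs] at h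
  exact (le_abs_self t).trans (le_of_mul_le_mul_right h (norm_pos_iff.2 hu0))

/-- Two norm-continuous families of positive injective compact operators have disjoint sets of
first `n` eigenvalues on an open set of parameters. -/
theorem isOpen_topEigenvalues_disjoint [CompleteSpace H] {X : Type*} [PseudoMetricSpace X]
    (hH : ¬ FiniteDimensional ℂ H) {A B : X → H →L[ℂ] H} (hA : Continuous A) (hB : Continuous B)
    (hAc : ∀ x, IsCompactOperator (A x)) (hBc : ∀ x, IsCompactOperator (B x))
    (hAs : ∀ x, (A x : H →ₗ[ℂ] H).IsSymmetric) (hBs : ∀ x, (B x : H →ₗ[ℂ] H).IsSymmetric)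
    (hpos : ∀ x u, 0 ≤ (⟪A x u, u⟫_ℂ).re) (hinj : ∀ x u, A x u = 0 → u = 0) (n : ℕ) :
    IsOpen {x | topEigenvalues (A x) n ∩ topEigenvalues (B x) n = ∅} := by
  rw [← isClosed_compl_iff]
  refine IsSeqClosed.isClosed fun x x₀ hx hx₀ => ?_
  have hx' : ∀ m, ∃ t, t ∈ topEigenvalues (A (x m)) n ∧ t ∈ topEigenvalues (B (x m)) n :=
    fun m => Set.nonempty_iff_ne_empty.2 (hx m)
  choose t htA htB using hx'
  have hAx : Tendsto (fun m => A (x m)) atTop (𝓝 (A x₀)) := (hA.tendsto x₀).comp hx₀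
  have hBx : Tendsto (fun m => B (x m)) atTop (𝓝 (B x₀)) := (hB.tendsto x₀).comp hx₀
  obtain ⟨c, hc, hcT⟩ := exists_lt_topEigenvalues hH (hAc x₀) (hAs x₀) (hpos x₀) (hinj x₀) n
  have hev : ∀ᶠ m in atTop, t m ∈ Set.Icc c (‖A x₀‖ + 1) := by
    have h0 : Tendsto (fun m => ‖A x₀ - A (x m)‖) atTop (𝓝 0) := by
      simpa using ((tendsto_const_nhds (x := A x₀)).sub hAx).norm
    filter_upwards [h0.eventually (gt_mem_nhds hc),
      hAx.norm.eventually (gt_mem_nhds (lt_add_one ‖A x₀‖))] with m h1 h2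
    exact ⟨hcT _ (hAc _) (hAs _) h1 _ (htA m), (le_norm_of_mem_topEigenvalues (htA m)).trans h2.le⟩
  obtain ⟨t₀, ht₀, φ, hφ, hlim⟩ := isCompact_Icc.tendsto_subseq' hev.frequently
  refine Set.nonempty_iff_ne_empty.1 ⟨t₀, ?_, ?_⟩
  · exact mem_topEigenvalues_of_tendsto (fun m => hAc (x (φ m))) (fun m => hAs (x (φ m))) (hAc x₀)
      (hAs x₀) (hAx.comp hφ.tendsto_atTop) hlim (hc.trans_le ht₀.1) (fun m => htA (φ m))
  · exact mem_topEigenvalues_of_tendsto (fun m => hBc (x (φ m))) (fun m => hBs (x (φ m))) (hBc x₀)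
      (hBs x₀) (hBx.comp hφ.tendsto_atTop) hlim (hc.trans_le ht₀.1) (fun m => htB (φ m))

end Abstract

/-! ### Resolvents of nonnegative symmetric graphs -/

section Resolvent

open Filter Topology
open scoped InnerProductSpace

variable {H : Type*} [NormedAddCommGroup H] [InnerProductSpace ℂ H]

/-- The graph `G` is that of a symmetric operator. -/
def IsSymmetricGraph (G : Submodule ℂ (H × H)) : Prop :=
  ∀ p ∈ G, ∀ q ∈ G, ⟪p.1, q.2⟫_ℂ = ⟪p.2, q.1⟫_ℂ

/-- The graph `G` is that of an operator with nonnegative quadratic form. -/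
def IsNonnegGraph (G : Submodule ℂ (H × H)) : Prop :=
  ∀ p ∈ G, 0 ≤ (⟪p.1, p.2⟫_ℂ).re

/-- `T = (A + 1)⁻¹`, where `A` is the operator with graph `G`. -/
def IsResolvent (G : Submodule ℂ (H × H)) (T : H →L[ℂ] H) : Prop :=
  ∀ f u, T f = u ↔ (u, f - u) ∈ G

theorem IsSymmetricGraph.topologicalClosure {G : Submodule ℂ (H × H)} (h : IsSymmetricGraph G) :
    IsSymmetricGraph G.topologicalClosure := by
  have h1 : ∀ p ∈ G, ∀ q ∈ G.topologicalClosure, ⟪p.1, q.2⟫_ℂ = ⟪p.2, q.1⟫_ℂ := fun p hp q hq =>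
    closure_minimal (s := (G : Set (H × H))) (t := {q | ⟪p.1, q.2⟫_ℂ = ⟪p.2, q.1⟫_ℂ})
      (fun q hq => h p hp q hq) (isClosed_eq (by fun_prop) (by fun_prop)) hq
  exact fun p hp q hq =>
    closure_minimal (s := (G : Set (H × H))) (t := {p | ⟪p.1, q.2⟫_ℂ = ⟪p.2, q.1⟫_ℂ})
      (fun p hp => h1 p hp q hq) (isClosed_eq (by fun_prop) (by fun_prop)) hp

theorem IsNonnegGraph.topologicalClosure {G : Submodule ℂ (H × H)} (h : IsNonnegGraph G) :
    IsNonnegGraph G.topologicalClosure := fun _ hp =>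
  closure_minimal (s := (G : Set (H × H))) (t := {p | 0 ≤ (⟪p.1, p.2⟫_ℂ).re})
    h (isClosed_le (by fun_prop) (by fun_prop)) hp

theorem IsNonnegGraph.norm_le {G : Submodule ℂ (H × H)} (h : IsNonnegGraph G) {p : H × H}
    (hp : p ∈ G) : ‖p‖ ≤ ‖p.1 + p.2‖ := by
  have h1 := norm_add_sq (𝕜 := ℂ) p.1 p.2
  have h2 : 0 ≤ RCLike.re ⟪p.1, p.2⟫_ℂ := h p hp
  rw [Prod.norm_def]
  refine max_le ?_ ?_ <;> refine le_of_sq_le_sq ?_ (norm_nonneg _) <;>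
    nlinarith [sq_nonneg ‖p.1‖, sq_nonneg ‖p.2‖]

/-- A nonnegative operator such that `A + 1` has dense range has a closure with everywhere
defined resolvent `(A + 1)⁻¹`: on the closed graph, `(u, v) ↦ u + v` is bounded below. -/
theorem exists_isResolvent [CompleteSpace H] {G : Submodule ℂ (H × H)} (h : IsNonnegGraph G)
    (hd : Dense {f | ∃ p ∈ G, p.1 + p.2 = f}) :
    ∃ T : H →L[ℂ] H, IsResolvent G.topologicalClosure T := by
  have hcl := h.topologicalClosure
  let e : G.topologicalClosure →ₗ[ℂ] H :=
    (LinearMap.fst ℂ H H + LinearMap.snd ℂ H H).comp G.topologicalClosure.subtype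
  have he : ∀ p, e p = (p : H × H).1 + (p : H × H).2 := fun p => rfl
  have hcomplete : CompleteSpace G.topologicalClosure :=
    G.isClosed_topologicalClosure.completeSpace_coe
  have hanti : AntilipschitzWith 1 e :=
    AddMonoidHomClass.antilipschitz_of_bound e fun p => by
      rw [NNReal.coe_one, one_mul, he]
      exact hcl.norm_le p.2
  have hcont : Continuous e := by
    change Continuous fun p : G.topologicalClosure => (p : H × H).1 + (p : H × H).2
    fun_prop
  have hrange : Set.range e = Set.univ := by
    have h1 : IsClosed (Set.range e) := by
      have hu : UniformContinuous e := by
        change UniformContinuous fun p : G.topologicalClosure => (p : H × H).1 + (p : H × H).2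
        exact (uniformContinuous_fst.comp uniformContinuous_subtype_val).add
          (uniformContinuous_snd.comp uniformContinuous_subtype_val)
      exact hanti.isClosed_range hu
    have h2 : Dense (Set.range e) := by
      refine hd.mono ?_
      rintro f ⟨p, hp, rfl⟩
      exact ⟨⟨p, G.le_topologicalClosure hp⟩, rfl⟩
    rw [← h1.closure_eq, h2.closure_eq]
  let E : G.topologicalClosure ≃ₗ[ℂ] H :=
    LinearEquiv.ofBijective e ⟨hanti.injective, Set.range_eq_univ.1 hrange⟩
  have hE : ∀ p, E p = (p : H × H).1 + (p : H × H).2 := fun p => rfl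
  refine ⟨LinearMap.mkContinuous ((LinearMap.fst ℂ H H).comp
    (G.topologicalClosure.subtype.comp (E.symm : H →ₗ[ℂ] G.topologicalClosure))) 1 fun f => ?_,
    fun f u => ?_⟩
  · rw [one_mul]
    have h1 := hcl.norm_le (E.symm f).2
    rw [← hE, LinearEquiv.apply_symm_apply] at h1
    exact (norm_fst_le _).trans h1
  · change ((E.symm f : H × H)).1 = u ↔ _
    constructor
    · rintro rfl
      have h1 : f = (E.symm f : H × H).1 + (E.symm f : H × H).2 := by
        rw [← hE, LinearEquiv.apply_symm_apply]
      have h2 : ((E.symm f : H × H).1, f - (E.symm f : H × H).1) = (E.symm f : H × H) := by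
        refine Prod.ext rfl ?_
        change f - (E.symm f : H × H).1 = (E.symm f : H × H).2
        rw [sub_eq_iff_eq_add']
        exact h1
      rw [h2]
      exact (E.symm f).2
    · intro hu
      have h1 : f = E ⟨(u, f - u), hu⟩ := by rw [hE]; simp
      rw [h1, LinearEquiv.symm_apply_apply]

namespace IsResolvent

variable {G : Submodule ℂ (H × H)} {T : H →L[ℂ] H}

theorem mem (h : IsResolvent G T) (f : H) : (T f, f - T f) ∈ G := (h f _).1 rfl

theorem apply_add (h : IsResolvent G T) {p : H × H} (hp : p ∈ G) : T (p.1 + p.2) = p.1 :=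
  (h _ _).2 (by simpa using hp)

theorem isSymmetric (h : IsResolvent G T) (hG : IsSymmetricGraph G) :
    (T : H →ₗ[ℂ] H).IsSymmetric := by
  intro f g
  have h1 := hG _ (h.mem f) _ (h.mem g)
  simp only [inner_sub_left, inner_sub_right] at h1
  have h2 : ⟪f, T g⟫_ℂ = ⟪T f, g⟫_ℂ := (sub_left_inj.1 h1).symm
  exact h2.symm

theorem re_inner_nonneg (h : IsResolvent G T) (hG : IsNonnegGraph G) (f : H) :
    0 ≤ (⟪T f, f⟫_ℂ).re := by
  have h1 := hG _ (h.mem f)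
  rw [inner_sub_right, inner_self_eq_norm_sq_to_K] at h1
  have h2 : (((‖T f‖ : ℝ) : ℂ) ^ 2).re = ‖T f‖ ^ 2 := by
    rw [← Complex.ofReal_pow, Complex.ofReal_re]
  simp only [Complex.coe_algebraMap, Complex.sub_re, h2] at h1
  nlinarith [sq_nonneg ‖T f‖]

/-- The resolvent is injective, as its kernel is orthogonal to the domain. -/
theorem eq_zero_of_apply_eq_zero (h : IsResolvent G T) (hG : IsSymmetricGraph G)
    (hd : Dense {u | ∃ p ∈ G, p.1 = u}) {f : H} (hf : T f = 0) : f = 0 := by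
  have h1 : (0, f) ∈ G := by simpa using (h f 0).1 hf
  refine hd.eq_zero_of_inner_left ℂ (x := f) ?_
  rintro u ⟨p, hp, rfl⟩
  simpa using (hG _ h1 p hp).symm

/-- Comparison of two resolvents through the difference of their sesquilinear forms. -/
theorem norm_sub_le {G' : Submodule ℂ (H × H)} {T' : H →L[ℂ] H}
    (h : IsResolvent G.topologicalClosure T) (h' : IsResolvent G'.topologicalClosure T')
    (hG' : IsSymmetricGraph G') {δ : ℝ} (hδ : 0 ≤ δ)
    (hle : ∀ p ∈ G, ∀ q ∈ G', ‖⟪p.1, q.2⟫_ℂ - ⟪p.2, q.1⟫_ℂ‖ ≤ δ * ‖p.1 + p.2‖ * ‖q.1 + q.2‖) :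
    ‖T - T'‖ ≤ δ := by
  have h1 : ∀ p ∈ G, ∀ q ∈ G'.topologicalClosure,
      ‖⟪p.1, q.2⟫_ℂ - ⟪p.2, q.1⟫_ℂ‖ ≤ δ * ‖p.1 + p.2‖ * ‖q.1 + q.2‖ := fun p hp q hq =>
    closure_minimal (s := (G' : Set (H × H)))
      (t := {q | ‖⟪p.1, q.2⟫_ℂ - ⟪p.2, q.1⟫_ℂ‖ ≤ δ * ‖p.1 + p.2‖ * ‖q.1 + q.2‖})
      (fun q hq => hle p hp q hq) (isClosed_le (by fun_prop) (by fun_prop)) hq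
  have h2 : ∀ p ∈ G.topologicalClosure, ∀ q ∈ G'.topologicalClosure,
      ‖⟪p.1, q.2⟫_ℂ - ⟪p.2, q.1⟫_ℂ‖ ≤ δ * ‖p.1 + p.2‖ * ‖q.1 + q.2‖ := fun p hp q hq =>
    closure_minimal (s := (G : Set (H × H)))
      (t := {p | ‖⟪p.1, q.2⟫_ℂ - ⟪p.2, q.1⟫_ℂ‖ ≤ δ * ‖p.1 + p.2‖ * ‖q.1 + q.2‖})
      (fun p hp => h1 p hp q hq) (isClosed_le (by fun_prop) (by fun_prop)) hp
  refine ContinuousLinearMap.opNorm_le_of_re_inner_le (𝕜 := ℂ) hδ fun f g hf hg => ?_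
  refine (RCLike.re_le_norm _).trans ?_
  have h3 := h2 _ (h.mem f) _ (h'.mem g)
  have h4 : ⟪T' f, g⟫_ℂ = ⟪f, T' g⟫_ℂ := h'.isSymmetric hG'.topologicalClosure f g
  have h5 : ⟪(T - T') f, g⟫_ℂ = ⟪T f, g - T' g⟫_ℂ - ⟪f - T f, T' g⟫_ℂ := by
    rw [_root_.sub_apply, inner_sub_left, inner_sub_left, inner_sub_right, h4]
    ring
  rw [h5]
  simpa [hf, hg] using h3

/-- The resolvent is compact if the elements of the domain can be approximated, uniformly on
bounded sets of `(A + 1) u`, from finite-dimensional spaces. -/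
theorem isCompactOperator [CompleteSpace H] (h : IsResolvent G.topologicalClosure T)
    (hd : Dense {f | ∃ p ∈ G, p.1 + p.2 = f})
    (hS : ∀ ε > 0, ∃ S : Submodule ℂ H, FiniteDimensional ℂ S ∧
      ∀ p ∈ G, ∃ s ∈ S, ‖p.1 - s‖ ≤ ε * ‖p.1 + p.2‖) : IsCompactOperator T := by
  choose! S hSfin hSle using hS
  obtain ⟨ε, -, hε, hlim⟩ := exists_seq_strictAnti_tendsto (0 : ℝ)
  have hfin : ∀ m, FiniteDimensional ℂ (S (ε m)) := fun m => hSfin _ (hε m)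
  let F : ℕ → H →L[ℂ] H := fun m => (S (ε m)).starProjection.comp T
  have hF : ∀ m, ‖F m - T‖ ≤ ε m := by
    intro m
    refine ContinuousLinearMap.opNorm_le_bound _ (hε m).le fun f => ?_
    have hcl : IsClosed {f | ‖(F m - T) f‖ ≤ ε m * ‖f‖} := isClosed_le (by fun_prop) (by fun_prop)
    refine closure_minimal ?_ hcl (hd f)
    rintro f ⟨p, hp, rfl⟩
    obtain ⟨s, hs, hsle⟩ := hSle _ (hε m) p hp
    have h1 : T (p.1 + p.2) = p.1 := h.apply_add (G.le_topologicalClosure hp)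
    refine le_trans ?_ hsle
    have h2 : (F m - T) (p.1 + p.2) = (S (ε m)).starProjection p.1 - p.1 := by
      change (S (ε m)).starProjection (T (p.1 + p.2)) - T (p.1 + p.2) = _
      rw [h1]
    rw [h2, norm_sub_rev, (S (ε m)).starProjection_minimal]
    exact ciInf_le ⟨0, by rintro _ ⟨x, rfl⟩; exact norm_nonneg _⟩ (⟨s, hs⟩ : S (ε m))
  refine isCompactOperator_of_tendsto (F := F) (l := atTop) ?_ (Eventually.of_forall fun m => ?_)
  · rw [tendsto_iff_norm_sub_tendsto_zero]
    exact squeeze_zero (fun m => norm_nonneg _) hF hlim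
  · have hproper : ProperSpace (S (ε m)) := FiniteDimensional.proper ℂ _
    have hc := isCompactOperator_of_locallyCompactSpace_dom
      ((S (ε m)).orthogonalProjectionOnto.comp T)
    exact hc.clm_comp (S (ε m)).subtypeL

end IsResolvent

end Resolvent

/-! ### Eigenvalues of an operator and of its resolvent -/

section Spectrum

variable {A : L2 →ₗ.[ℂ] L2} {T : L2 →L[ℂ] L2}

open scoped InnerProductSpace

theorem mem_eigenspace_iff_mem_graph (A : L2 →ₗ.[ℂ] L2) (lam : ℝ) (u : L2) :
    u ∈ eigenspace A lam ↔ (u, (lam : ℂ) • u) ∈ A.graph := by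
  rw [mem_eigenspace, LinearPMap.mem_graph_iff']
  constructor
  · rintro ⟨h, hu⟩
    exact ⟨⟨u, h⟩, by rw [hu]⟩
  · rintro ⟨y, hy⟩
    obtain rfl : (y : L2) = u := congrArg Prod.fst hy
    exact ⟨y.2, congrArg Prod.snd hy⟩

theorem mem_eigenspace_iff_resolvent (h : IsResolvent A.graph T) (lam : ℝ) (u : L2) :
    u ∈ eigenspace A lam ↔ ((1 + lam : ℝ) : ℂ) • T u = u := by
  rw [mem_eigenspace_iff_mem_graph, ← map_smul, h]
  have : ((1 + lam : ℝ) : ℂ) • u - u = (lam : ℂ) • u := by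
    push_cast
    module
  rw [this]

theorem eigenspace_eq_of_neg_one_lt (h : IsResolvent A.graph T) {lam : ℝ} (hl : -1 < lam) :
    eigenspace A lam = Module.End.eigenspace (T : L2 →ₗ[ℂ] L2) (((1 + lam)⁻¹ : ℝ) : ℂ) := by
  ext u
  have h0 : ((1 + lam : ℝ) : ℂ) ≠ 0 := by
    exact_mod_cast (by linarith : (0 : ℝ) < 1 + lam).ne'
  rw [mem_eigenspace_iff_resolvent h, Module.End.mem_eigenspace_iff, Complex.ofReal_inv,
    ContinuousLinearMap.coe_coe]
  constructor
  · intro hu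
    rw [eq_inv_smul_iff₀ h0, hu]
  · intro hu
    rw [hu, smul_inv_smul₀ h0]

theorem eigenspace_eq_bot_of_le_neg_one (hG : IsNonnegGraph A.graph)
    {lam : ℝ} (hl : lam ≤ -1) : eigenspace A lam = ⊥ := by
  rw [Submodule.eq_bot_iff]
  intro u hu
  have h1 := hG _ ((mem_eigenspace_iff_mem_graph A lam u).1 hu)
  simp only at h1
  rw [inner_smul_right, inner_self_eq_norm_sq_to_K] at h1
  have h2 : 0 ≤ lam * ‖u‖ ^ 2 := by
    simpa [← Complex.ofReal_pow] using h1
  have h3 : ‖u‖ ^ 2 = 0 := le_antisymm (by nlinarith [sq_nonneg ‖u‖]) (sq_nonneg _)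
  simpa using h3

/-- The eigenvalues of an operator and of its resolvent correspond under the decreasing map
`lam ↦ (1 + lam)⁻¹`, with the same multiplicities. -/
theorem mem_firstEigenvalues_iff (h : IsResolvent A.graph T) (hG : IsNonnegGraph A.graph)
    (n : ℕ) (lam : ℝ) :
    lam ∈ firstEigenvalues A n ↔ -1 < lam ∧ (1 + lam)⁻¹ ∈ topEigenvalues T n := by
  by_cases hl : -1 < lam
  · have hpos : 0 < 1 + lam := by linarith
    have hsup : (⨆ μ : {μ : ℝ // μ < lam}, eigenspace A μ) = eigenspacesAbove T (1 + lam)⁻¹ := by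
      refine le_antisymm (iSup_le fun μ => ?_) (iSup_le fun s => ?_)
      · by_cases hμ : -1 < (μ : ℝ)
        · rw [eigenspace_eq_of_neg_one_lt h hμ]
          refine eigenspace_le_eigenspacesAbove T ?_
          exact inv_strictAnti₀ (by linarith) (by linarith [μ.2])
        · rw [eigenspace_eq_bot_of_le_neg_one hG (not_lt.1 hμ)]
          exact bot_le
      · have hs : 0 < (s : ℝ) := (inv_pos.2 hpos).trans s.2
        have h1 : (s : ℝ)⁻¹ - 1 < lam := by
          have := inv_strictAnti₀ (inv_pos.2 hpos) s.2
          rw [inv_inv] at this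
          linarith
        have h2 : -1 < (s : ℝ)⁻¹ - 1 := by linarith [inv_pos.2 hs]
        have h3 := eigenspace_eq_of_neg_one_lt h h2
        rw [add_sub_cancel, inv_inv] at h3
        rw [← h3]
        exact le_iSup (fun μ : {μ : ℝ // μ < lam} => eigenspace A μ) ⟨_, h1⟩
    rw [firstEigenvalues, topEigenvalues, Set.mem_ofPred_eq, Set.mem_ofPred_eq, hsup,
      eigenspace_eq_of_neg_one_lt h hl]
    simp [hl, hpos]
  · exact iff_of_false (fun hm => hm.1 (eigenspace_eq_bot_of_le_neg_one hG (not_lt.1 hl)))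
      fun hm => hl hm.1

theorem firstEigenvalues_inter_eq_empty_iff {B : L2 →ₗ.[ℂ] L2} {S : L2 →L[ℂ] L2}
    (hA : IsResolvent A.graph T) (hA' : IsNonnegGraph A.graph)
    (hB : IsResolvent B.graph S) (hB' : IsNonnegGraph B.graph) (n : ℕ) :
    firstEigenvalues A n ∩ firstEigenvalues B n = ∅ ↔
      topEigenvalues T n ∩ topEigenvalues S n = ∅ := by
  simp only [Set.eq_empty_iff_forall_notMem, Set.mem_inter_iff, mem_firstEigenvalues_iff hA hA',
    mem_firstEigenvalues_iff hB hB']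
  constructor
  · rintro h t ⟨h1, h2⟩
    have h3 : -1 < t⁻¹ - 1 := by linarith [inv_pos.2 h1.1]
    refine h (t⁻¹ - 1) ⟨⟨h3, ?_⟩, h3, ?_⟩ <;> rwa [add_sub_cancel, inv_inv]
  · rintro h lam ⟨⟨-, h1⟩, -, h2⟩
    exact h _ ⟨h1, h2⟩

end Spectrum

/-! ### Square-integrable weak solutions of `h'' = q h` -/

section WeakSolutions

open Filter Topology Set

theorem integrable_mul_of_locallyIntegrable {w φ : ℝ → ℝ} (hw : LocallyIntegrable w)
    (hφ : Continuous φ) (hc : HasCompactSupport φ) : Integrable fun x => w x * φ x := by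
  simpa [smul_eq_mul, mul_comm] using hw.integrable_smul_left_of_hasCompactSupport hφ hc

theorem intervalIntegrable_of_locallyIntegrable {p : ℝ → ℝ} (hp : LocallyIntegrable p) (a b : ℝ) :
    IntervalIntegrable p volume a b :=
  intervalIntegrable_iff.2 ((hp.integrableOn_isCompact isCompact_uIcc).mono_set uIoc_subset_uIcc)

theorem exists_support_subset_Ioc {E : Type*} [Zero E] {φ : ℝ → E} (hc : HasCompactSupport φ) :
    ∃ R > 0, Function.support φ ⊆ Ioc (-R) R := by
  obtain ⟨R, hR⟩ := hc.isCompact.isBounded.subset_closedBall 0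
  refine ⟨|R| + 1, by positivity, fun x hx => ?_⟩
  have h1 := hR (subset_tsupport φ hx)
  rw [Real.closedBall_eq_Icc] at h1
  have := le_abs_self R
  exact ⟨by linarith [h1.1], by linarith [h1.2]⟩

/-- Integration by parts against the primitive of a locally integrable function, which is only
absolutely continuous. -/
theorem integral_primitive_mul_deriv {p φ : ℝ → ℝ} (hp : LocallyIntegrable p)
    (hφ : ContDiff ℝ 1 φ) (hc : HasCompactSupport φ) :
    ∫ x, (∫ t in (0 : ℝ)..x, p t) * deriv φ x = - ∫ x, p x * φ x := by
  obtain ⟨R, hR, hs⟩ := exists_support_subset_Ioc hc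
  obtain ⟨R', hR', hs'⟩ := exists_support_subset_Ioc hc.deriv
  obtain ⟨M, hM, hMR, hMR'⟩ : ∃ M > 0, R < M ∧ R' < M :=
    ⟨R + R' + 1, by linarith, by linarith, by linarith⟩
  have hsM : Function.support φ ⊆ Ioc (-M) M :=
    hs.trans (Ioc_subset_Ioc (by linarith) (by linarith))
  have hsM' : Function.support (deriv φ) ⊆ Ioc (-M) M :=
    hs'.trans (Ioc_subset_Ioc (by linarith) (by linarith))
  have hz : ∀ x, x ∉ Ioc (-R) R → φ x = 0 := fun x hx => by
    by_contra h
    exact hx (hs h)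
  have hi : IntervalIntegrable p volume (-M) M := intervalIntegrable_of_locallyIntegrable hp _ _
  have h1 : AbsolutelyContinuousOnInterval (fun x => ∫ t in (0 : ℝ)..x, p t) (-M) M :=
    hi.absolutelyContinuousOnInterval_intervalIntegral (by
      rw [uIcc_of_le (by linarith)]; exact ⟨by linarith, by linarith⟩)
  have h2 : AbsolutelyContinuousOnInterval φ (-M) M :=
    hφ.contDiffOn.absolutelyContinuousOnInterval
  have h3 := h1.integral_mul_deriv_eq_deriv_mul h2
  rw [hz M (fun h => by linarith [h.2]), hz (-M) (fun h => by linarith [h.1])] at h3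
  have h4 : ∫ x in (-M)..M, deriv (fun x => ∫ t in (0 : ℝ)..x, p t) x * φ x
      = ∫ x in (-M)..M, p x * φ x := by
    refine intervalIntegral.integral_congr_ae ?_
    filter_upwards [LocallyIntegrable.ae_hasDerivAt_integral hp] with x hx _
    rw [(hx 0).deriv]
  rw [h4, intervalIntegral.integral_eq_integral_of_support_subset (f := fun x => p x * φ x)
      ((Function.support_mul_subset_right _ _).trans hsM),
    intervalIntegral.integral_eq_integral_of_support_subset
      ((Function.support_mul_subset_right _ _).trans hsM')] at h3
  simpa using h3

/-- A test function with integral zero is the derivative of a test function. -/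
theorem exists_deriv_eq_of_integral_eq_zero {ψ : ℝ → ℝ} (hψ : ContDiff ℝ ∞ ψ)
    (hc : HasCompactSupport ψ) (h0 : ∫ x, ψ x = 0) :
    ∃ φ : ℝ → ℝ, ContDiff ℝ ∞ φ ∧ HasCompactSupport φ ∧ deriv φ = ψ := by
  obtain ⟨R, hR, hs⟩ := exists_support_subset_Ioc hc
  have hz : ∀ x, x ∉ Ioc (-R) R → ψ x = 0 := fun x hx => by
    by_contra h
    exact hx (hs h)
  have hd : ∀ x, HasDerivAt (fun x => ∫ t in (-R)..x, ψ t) (ψ x) x := fun x =>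
    intervalIntegral.integral_hasDerivAt_right (hψ.continuous.intervalIntegrable _ _)
      (hψ.continuous.stronglyMeasurableAtFilter _ _) hψ.continuous.continuousAt
  have hderiv : deriv (fun x => ∫ t in (-R)..x, ψ t) = ψ := funext fun x => (hd x).deriv
  refine ⟨fun x => ∫ t in (-R)..x, ψ t, ?_, ?_, hderiv⟩
  · exact contDiff_infty_iff_deriv.2 ⟨fun x => (hd x).differentiableAt, by rwa [hderiv]⟩
  · refine HasCompactSupport.intro (K := Icc (-R) R) isCompact_Icc fun x hx => ?_
    rcases lt_or_ge x (-R) with hlt | hge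
    · refine (intervalIntegral.integral_congr (g := fun _ => 0) fun t ht => ?_).trans (by simp)
      rw [uIcc_of_ge hlt.le] at ht
      exact hz t fun h => by linarith [h.1, ht.2]
    · have hlt : R < x := by
        by_contra! h
        exact hx ⟨hge, h⟩
      rw [intervalIntegral.integral_eq_integral_of_support_subset
        (hs.trans (Ioc_subset_Ioc le_rfl hlt.le)), h0]

theorem exists_contDiff_integral_eq_one :
    ∃ η : ℝ → ℝ, ContDiff ℝ ∞ η ∧ HasCompactSupport η ∧ ∫ x, η x = 1 := by
  let f : ContDiffBump (0 : ℝ) := ⟨1, 2, one_pos, one_lt_two⟩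
  exact ⟨f.normed volume, f.contDiff_normed, f.hasCompactSupport_normed, f.integral_normed⟩

/-- The lemma of du Bois-Reymond: a function with vanishing weak derivative is constant. -/
theorem exists_ae_eq_const {w : ℝ → ℝ} (hw : LocallyIntegrable w)
    (h : ∀ φ : ℝ → ℝ, ContDiff ℝ ∞ φ → HasCompactSupport φ → ∫ x, w x * deriv φ x = 0) :
    ∃ c, w =ᵐ[volume] fun _ => c := by
  obtain ⟨η, hη, hcη, hη1⟩ := exists_contDiff_integral_eq_one
  refine ⟨∫ x, w x * η x, ae_eq_of_integral_contDiff_smul_eq hw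
    (locallyIntegrable_const _) fun ψ hψ hcψ => ?_⟩
  have hηi : Integrable η := hη.continuous.integrable_of_hasCompactSupport hcη
  have hψi : Integrable ψ := hψ.continuous.integrable_of_hasCompactSupport hcψ
  have hsm : ContDiff ℝ ∞ fun x => ψ x - (∫ y, ψ y) * η x := hψ.sub (contDiff_const.mul hη)
  have hcs : HasCompactSupport fun x => ψ x - (∫ y, ψ y) * η x :=
    hcψ.sub (hcη.mul_left (f := fun _ => ∫ y, ψ y))
  obtain ⟨φ, hφ, hcφ, hd⟩ := exists_deriv_eq_of_integral_eq_zero hsm hcs (by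
    rw [integral_sub hψi (hηi.const_mul _), integral_const_mul, hη1]; ring)
  have h1 := h φ hφ hcφ
  rw [hd] at h1
  have e : ∀ x, w x * (ψ x - (∫ y, ψ y) * η x) = w x * ψ x - (∫ y, ψ y) * (w x * η x) :=
    fun x => by ring
  simp only [e] at h1
  rw [integral_sub (integrable_mul_of_locallyIntegrable hw hψ.continuous hcψ)
    ((integrable_mul_of_locallyIntegrable hw hη.continuous hcη).const_mul _),
    integral_const_mul] at h1
  simp only [smul_eq_mul, integral_mul_const]
  rw [← sub_eq_zero.1 h1]
  simp only [mul_comm]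

theorem locallyIntegrable_primitive {p : ℝ → ℝ} (hp : LocallyIntegrable p) :
    LocallyIntegrable fun x => ∫ t in (0 : ℝ)..x, p t :=
  (intervalIntegral.continuous_primitive
    (fun _ _ => intervalIntegrable_of_locallyIntegrable hp _ _) 0).locallyIntegrable

/-- A locally integrable function with locally integrable weak derivative `p` is almost
everywhere a primitive of `p`. -/
theorem exists_ae_eq_primitive {w p : ℝ → ℝ} (hw : LocallyIntegrable w) (hp : LocallyIntegrable p)
    (h : ∀ φ : ℝ → ℝ, ContDiff ℝ ∞ φ → HasCompactSupport φ →
      ∫ x, w x * deriv φ x = - ∫ x, p x * φ x) :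
    ∃ c, w =ᵐ[volume] fun x => c + ∫ t in (0 : ℝ)..x, p t := by
  have hP := locallyIntegrable_primitive hp
  obtain ⟨c, hc⟩ := exists_ae_eq_const (hw.sub hP) fun φ hφ hcφ => by
    have hd : Continuous (deriv φ) := hφ.continuous_deriv (by simp)
    simp only [Pi.sub_apply, sub_mul]
    rw [integral_sub (integrable_mul_of_locallyIntegrable hw hd hcφ.deriv)
      (integrable_mul_of_locallyIntegrable hP hd hcφ.deriv), h φ hφ hcφ,
      integral_primitive_mul_deriv hp (hφ.of_le (by simp)) hcφ, sub_self]
  refine ⟨c, ?_⟩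
  filter_upwards [hc] with x hx
  rw [Pi.sub_apply] at hx
  linarith

/-- A function whose weak second derivative is the locally integrable function `p` agrees almost
everywhere with a `C¹` function, whose derivative is a primitive of `p`. -/
theorem exists_ae_eq_of_weak_second_deriv {h p : ℝ → ℝ} (hh : LocallyIntegrable h)
    (hp : LocallyIntegrable p)
    (hw : ∀ φ : ℝ → ℝ, ContDiff ℝ ∞ φ → HasCompactSupport φ →
      ∫ x, h x * deriv (deriv φ) x = ∫ x, p x * φ x) :
    ∃ (u : ℝ → ℝ) (a : ℝ), h =ᵐ[volume] u ∧
      ∀ x, HasDerivAt u ((∫ t in (0 : ℝ)..x, p t) - a) x := by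
  obtain ⟨η, hη, hcη, hη1⟩ := exists_contDiff_integral_eq_one
  have hηi : Integrable η := hη.continuous.integrable_of_hasCompactSupport hcη
  set P : ℝ → ℝ := fun x => ∫ t in (0 : ℝ)..x, p t with hPdef
  have hPc : Continuous P :=
    intervalIntegral.continuous_primitive
      (fun _ _ => intervalIntegrable_of_locallyIntegrable hp _ _) 0
  have hP : LocallyIntegrable P := hPc.locallyIntegrable
  set a : ℝ := (∫ x, h x * deriv η x) + ∫ x, P x * η x with ha
  have hdη : Continuous (deriv η) := hη.continuous_deriv (by simp)
  obtain ⟨c, hc⟩ := exists_ae_eq_primitive (w := h) (p := fun x => P x - a) hh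
    (hP.sub (locallyIntegrable_const a)) fun ψ hψ hcψ => by
    have hψi : Integrable ψ := hψ.continuous.integrable_of_hasCompactSupport hcψ
    have hdψ : Continuous (deriv ψ) := hψ.continuous_deriv (by simp)
    have hsm : ContDiff ℝ ∞ fun x => ψ x - (∫ y, ψ y) * η x := hψ.sub (contDiff_const.mul hη)
    have hcs : HasCompactSupport fun x => ψ x - (∫ y, ψ y) * η x :=
      hcψ.sub (hcη.mul_left (f := fun _ => ∫ y, ψ y))
    -- Testing with an antiderivative of the mean-zero part of `ψ` removes one derivative.
    obtain ⟨φ, hφ, hcφ, hd⟩ := exists_deriv_eq_of_integral_eq_zero hsm hcs (by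
      rw [integral_sub hψi (hηi.const_mul _), integral_const_mul, hη1]; ring)
    have h1 := hw φ hφ hcφ
    have h2 := integral_primitive_mul_deriv hp (hφ.of_le (by simp)) hcφ
    have hdd : deriv (deriv φ) = fun x => deriv ψ x - (∫ y, ψ y) * deriv η x := by
      rw [hd]
      funext x
      have d1 : HasDerivAt ψ (deriv ψ x) x := (hψ.differentiable (by simp) x).hasDerivAt
      have d2 : HasDerivAt η (deriv η x) x := (hη.differentiable (by simp) x).hasDerivAt
      exact (d1.sub (d2.const_mul _)).deriv
    rw [hdd] at h1
    rw [hd] at h2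
    have e1 : ∀ x, h x * (deriv ψ x - (∫ y, ψ y) * deriv η x)
        = h x * deriv ψ x - (∫ y, ψ y) * (h x * deriv η x) := fun x => by ring
    have e2 : ∀ x, P x * (ψ x - (∫ y, ψ y) * η x)
        = P x * ψ x - (∫ y, ψ y) * (P x * η x) := fun x => by ring
    change ∫ x, P x * (ψ x - (∫ y, ψ y) * η x) = _ at h2
    simp only [e1] at h1
    simp only [e2] at h2
    rw [integral_sub (integrable_mul_of_locallyIntegrable hh hdψ hcψ.deriv)
      ((integrable_mul_of_locallyIntegrable hh hdη hcη.deriv).const_mul _),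
      integral_const_mul] at h1
    rw [integral_sub (integrable_mul_of_locallyIntegrable hP hψ.continuous hcψ)
      ((integrable_mul_of_locallyIntegrable hP hη.continuous hcη).const_mul _),
      integral_const_mul] at h2
    simp only [sub_mul]
    rw [integral_sub (integrable_mul_of_locallyIntegrable hP hψ.continuous hcψ)
      (hψi.const_mul _), integral_const_mul]
    rw [ha]
    linear_combination h1 + h2
  refine ⟨_, a, hc, fun x => ?_⟩
  have hcont : Continuous fun x => P x - a := hPc.sub continuous_const
  exact (intervalIntegral.integral_hasDerivAt_right (hcont.intervalIntegrable _ _)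
    (hcont.stronglyMeasurableAtFilter _ _) hcont.continuousAt).const_add c

theorem eq_zero_of_convexOn_of_integrable {f : ℝ → ℝ} (hf : ConvexOn ℝ univ f)
    (hnn : ∀ x, 0 ≤ f x) (hi : Integrable f) (x : ℝ) : f x = 0 := by
  -- By convexity the constant `f x` is dominated by an integrable function.
  have h1 : Integrable fun t : ℝ => (1 / 2 : ℝ) * f (x + t) + (1 / 2 : ℝ) * f (x - t) :=
    ((hi.comp_add_left x).const_mul _).add ((hi.comp_sub_left x).const_mul _)
  have h2 : Integrable fun _ : ℝ => f x := by
    refine h1.mono' aestronglyMeasurable_const (ae_of_all _ fun t => ?_)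
    rw [Real.norm_eq_abs, abs_of_nonneg (hnn x)]
    have := hf.2 (mem_univ (x + t)) (mem_univ (x - t)) (by norm_num : (0 : ℝ) ≤ 1 / 2)
      (by norm_num : (0 : ℝ) ≤ 1 / 2) (by norm_num)
    simp only [smul_eq_mul] at this
    have e : (1 / 2 : ℝ) * (x + t) + 1 / 2 * (x - t) = x := by ring
    rwa [e] at this
  rcases (integrable_const_iff.1 h2) with h | h
  · exact h
  · exact absurd h (by simp [isFiniteMeasure_iff])

/-- A square-integrable weak solution of `h'' = q h` with `q ≥ 0` continuous vanishes: it is a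
classical solution, so `h ^ 2` is convex. -/
theorem ae_eq_zero_of_weak_solution {q h : ℝ → ℝ} (hq : Continuous q) (hq0 : ∀ x, 0 ≤ q x)
    (hh : MemLp h 2)
    (hw : ∀ φ : ℝ → ℝ, ContDiff ℝ ∞ φ → HasCompactSupport φ →
      ∫ x, h x * (-deriv (deriv φ) x + q x * φ x) = 0) : h =ᵐ[volume] 0 := by
  have hloc : LocallyIntegrable h := hh.locallyIntegrable (by norm_num)
  have hp : LocallyIntegrable fun x => q x * h x := by
    simpa using hloc.continuous_smul hq
  obtain ⟨u, a, hu, hd⟩ := exists_ae_eq_of_weak_second_deriv hloc hp fun φ hφ hcφ => by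
    have hdd : Continuous (deriv (deriv φ)) :=
      (contDiff_infty_iff_deriv.1 hφ).2.continuous_deriv (by simp)
    have e : ∀ x, h x * (-deriv (deriv φ) x + q x * φ x)
        = (q x * h x) * φ x - h x * deriv (deriv φ) x := fun x => by ring
    have h1 := hw φ hφ hcφ
    simp only [e] at h1
    rw [integral_sub (integrable_mul_of_locallyIntegrable hp hφ.continuous hcφ)
      (integrable_mul_of_locallyIntegrable hloc hdd hcφ.deriv.deriv)] at h1
    linarith
  have hucont : Continuous u := continuous_iff_continuousAt.2 fun x => (hd x).continuousAt
  have hP : ∀ x, ∫ t in (0 : ℝ)..x, q t * h t = ∫ t in (0 : ℝ)..x, q t * u t := fun x => by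
    refine intervalIntegral.integral_congr_ae ?_
    filter_upwards [hu] with t ht _
    rw [ht]
  simp only [hP] at hd
  set v : ℝ → ℝ := fun x => (∫ t in (0 : ℝ)..x, q t * u t) - a with hv
  have hqu : Continuous fun t => q t * u t := hq.mul hucont
  have hd2 : ∀ x, HasDerivAt v (q x * u x) x := fun x =>
    (intervalIntegral.integral_hasDerivAt_right (hqu.intervalIntegrable _ _)
      (hqu.stronglyMeasurableAtFilter _ _) hqu.continuousAt).sub_const a
  have h1 : ∀ x, HasDerivAt (fun x => u x ^ 2) (2 * (u x * v x)) x := fun x => by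
    refine ((hd x).pow 2).congr_deriv ?_
    push_cast
    ring
  have h2 : ∀ x, HasDerivAt (fun x => 2 * (u x * v x)) (2 * (v x ^ 2 + q x * u x ^ 2)) x :=
    fun x => by
      refine (((hd x).mul (hd2 x)).const_mul 2).congr_deriv ?_
      simp only [hv]
      ring
  have e1 : deriv (fun x => u x ^ 2) = fun x => 2 * (u x * v x) := funext fun x => (h1 x).deriv
  have hconv : ConvexOn ℝ univ fun x => u x ^ 2 := by
    refine convexOn_univ_of_deriv2_nonneg (fun x => (h1 x).differentiableAt) ?_ fun x => ?_
    · rw [e1]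
      exact fun x => (h2 x).differentiableAt
    · rw [Function.iterate_succ, Function.iterate_one, Function.comp_apply, e1, (h2 x).deriv]
      have := mul_nonneg (hq0 x) (sq_nonneg (u x))
      positivity
  have hint : Integrable fun x => u x ^ 2 := (hh.ae_eq hu).integrable_sq
  filter_upwards [hu] with x hx
  rw [hx]
  simpa using eq_zero_of_convexOn_of_integrable hconv (fun x => sq_nonneg _) hint x

end WeakSolutions

/-! ### The quadratic form of the Schrödinger operator -/

section Form

open Filter Topology Set
open scoped InnerProductSpace ComplexConjugate

variable {V V' : ℝ → ℝ} {k : ℤ} {φ ψ : ℝ → ℂ}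

theorem continuous_deriv_of_smooth (hφ : ContDiff ℝ ∞ φ) : Continuous (deriv φ) :=
  hφ.continuous_deriv (by simp)

theorem contDiff_deriv_of_smooth (hφ : ContDiff ℝ ∞ φ) : ContDiff ℝ ∞ (deriv φ) :=
  (contDiff_infty_iff_deriv.1 hφ).2

theorem hasDerivAt_of_smooth (hφ : ContDiff ℝ ∞ φ) (x : ℝ) : HasDerivAt φ (deriv φ x) x :=
  (hφ.differentiable (by simp) x).hasDerivAt

theorem integral_conj_mul_deriv_deriv (hφ : ContDiff ℝ ∞ φ) (hcφ : HasCompactSupport φ)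
    (hψ : ContDiff ℝ ∞ ψ) :
    ∫ x, conj (φ x) * deriv (deriv ψ) x = - ∫ x, conj (deriv φ x) * deriv ψ x := by
  have hcs : HasCompactSupport fun x => conj (φ x) := hcφ.comp_left (map_zero _)
  have hcs' : HasCompactSupport fun x => conj (deriv φ x) := hcφ.deriv.comp_left (map_zero _)
  have hc1 : Continuous fun x => conj (φ x) := Complex.continuous_conj.comp hφ.continuous
  have hc2 : Continuous fun x => conj (deriv φ x) :=
    Complex.continuous_conj.comp (continuous_deriv_of_smooth hφ)
  have hψ' := contDiff_deriv_of_smooth hψ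
  refine integral_mul_deriv_eq_deriv_mul_of_integrable (u := fun x => conj (φ x)) (v := deriv ψ)
    (fun x _ => (hasDerivAt_of_smooth hφ x).star) (fun x _ => hasDerivAt_of_smooth hψ' x) ?_ ?_ ?_
  · exact (hc1.mul (continuous_deriv_of_smooth hψ')).integrable_of_hasCompactSupport hcs.mul_right
  · exact (hc2.mul hψ'.continuous).integrable_of_hasCompactSupport hcs'.mul_right
  · exact (hc1.mul hψ'.continuous).integrable_of_hasCompactSupport hcs.mul_right

/-- The sesquilinear form of `-∂ₓ² + k² V` on smooth compactly supported functions. -/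
noncomputable def form (V : ℝ → ℝ) (k : ℤ) (φ ψ : ℝ → ℂ) : ℂ :=
  (∫ x, conj (deriv φ x) * deriv ψ x) + ∫ x, ((((k : ℝ) ^ 2 * V x : ℝ)) : ℂ) * (conj (φ x) * ψ x)

theorem form_conj_symm (V : ℝ → ℝ) (k : ℤ) (φ ψ : ℝ → ℂ) :
    conj (form V k φ ψ) = form V k ψ φ := by
  simp only [form, map_add, ← integral_conj, map_mul, Complex.conj_conj, Complex.conj_ofReal]
  simp only [mul_comm]

theorem integrable_potential_term (hV : Continuous V) (hφ : ContDiff ℝ ∞ φ)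
    (hcφ : HasCompactSupport φ) (hψ : ContDiff ℝ ∞ ψ) :
    Integrable fun x => ((((k : ℝ) ^ 2 * V x : ℝ)) : ℂ) * (conj (φ x) * ψ x) := by
  have hcs : HasCompactSupport fun x => conj (φ x) := hcφ.comp_left (map_zero _)
  have h1 := hφ.continuous
  have h2 := hψ.continuous
  exact (Continuous.mul (by fun_prop) ((Complex.continuous_conj.comp h1).mul h2)
    ).integrable_of_hasCompactSupport (hcs.mul_right.mul_left)

theorem inner_eq_form (hV : Continuous V) {u w : L2} (hφ : ContDiff ℝ ∞ φ)
    (hcφ : HasCompactSupport φ) (hψ : ContDiff ℝ ∞ ψ)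
    (hu : u =ᵐ[volume] φ)
    (hw : w =ᵐ[volume] fun x => -deriv (deriv ψ) x + (k : ℂ) ^ 2 * (V x : ℂ) * ψ x) :
    ⟪u, w⟫_ℂ = form V k φ ψ := by
  have hψ' := contDiff_deriv_of_smooth hψ
  have hcs : HasCompactSupport fun x => conj (φ x) := hcφ.comp_left (map_zero _)
  have hc1 : Continuous fun x => conj (φ x) := Complex.continuous_conj.comp hφ.continuous
  have h1 : Integrable fun x => -(conj (φ x) * deriv (deriv ψ) x) := Integrable.neg <|
    (hc1.mul (continuous_deriv_of_smooth hψ')).integrable_of_hasCompactSupport hcs.mul_right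
  rw [L2.inner_def, form, ← neg_neg (∫ x, conj (deriv φ x) * deriv ψ x),
    ← integral_conj_mul_deriv_deriv hφ hcφ hψ, ← integral_neg,
    ← integral_add h1 (integrable_potential_term hV hφ hcφ hψ)]
  refine integral_congr_ae ?_
  filter_upwards [hu, hw] with x hx1 hx2
  rw [hx1, hx2, RCLike.inner_apply]
  push_cast
  ring

theorem inner_eq_form' (hV : Continuous V) {u w : L2} (hφ : ContDiff ℝ ∞ φ)
    (hψ : ContDiff ℝ ∞ ψ) (hcψ : HasCompactSupport ψ)
    (hw : w =ᵐ[volume] fun x => -deriv (deriv φ) x + (k : ℂ) ^ 2 * (V x : ℂ) * φ x)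
    (hu : u =ᵐ[volume] ψ) : ⟪w, u⟫_ℂ = form V k φ ψ := by
  rw [← inner_conj_symm, inner_eq_form hV hψ hcψ hφ hu hw, form_conj_symm]

theorem isSymmetricGraph_testGraph (hV : Continuous V) : IsSymmetricGraph (testGraph V k) := by
  rintro p ⟨φ, hφ, hcφ, hp1, hp2⟩ q ⟨ψ, hψ, hcψ, hq1, hq2⟩
  rw [inner_eq_form hV hφ hcφ hψ hp1 hq2, inner_eq_form' hV hφ hψ hcψ hp2 hq1]

theorem form_self (V : ℝ → ℝ) (k : ℤ) (φ : ℝ → ℂ) :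
    (form V k φ φ).re = (∫ x, ‖deriv φ x‖ ^ 2) + ∫ x, (k : ℝ) ^ 2 * V x * ‖φ x‖ ^ 2 := by
  have e : ∀ z : ℂ, conj z * z = ((‖z‖ ^ 2 : ℝ) : ℂ) := fun z => by
    rw [Complex.conj_mul']
    push_cast
    rfl
  simp only [form, e, ← Complex.ofReal_mul, integral_complex_ofReal, ← Complex.ofReal_add,
    Complex.ofReal_re]

theorem isNonnegGraph_testGraph (hV : Continuous V) (hV0 : ∀ x, 0 ≤ V x) :
    IsNonnegGraph (testGraph V k) := by
  rintro p ⟨φ, hφ, hcφ, hp1, hp2⟩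
  rw [inner_eq_form hV hφ hcφ hφ hp1 hp2, form_self]
  refine add_nonneg (integral_nonneg fun x => by positivity) (integral_nonneg fun x => ?_)
  have := hV0 x
  positivity

/-- The quadratic form is bounded by the square of the graph norm `‖(A + 1) φ‖`. -/
theorem energy_le (hV : Continuous V) (hV0 : ∀ x, 0 ≤ V x) {p : L2 × L2}
    (hφ : ContDiff ℝ ∞ φ) (hcφ : HasCompactSupport φ) (hp1 : p.1 =ᵐ[volume] φ)
    (hp2 : p.2 =ᵐ[volume] fun x => -deriv (deriv φ) x + (k : ℂ) ^ 2 * (V x : ℂ) * φ x) :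
    (∫ x, ‖deriv φ x‖ ^ 2) + ∫ x, (k : ℝ) ^ 2 * V x * ‖φ x‖ ^ 2 ≤ ‖p.1 + p.2‖ ^ 2 := by
  have hp : p ∈ testGraph V k := ⟨φ, hφ, hcφ, hp1, hp2⟩
  have h := (isNonnegGraph_testGraph (k := k) hV hV0).norm_le hp
  rw [← form_self, ← inner_eq_form hV hφ hcφ hφ hp1 hp2, sq]
  refine (Complex.re_le_norm _).trans ((norm_inner_le_norm _ _).trans ?_)
  exact mul_le_mul ((norm_fst_le p).trans h) ((norm_snd_le p).trans h) (norm_nonneg _)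
    (norm_nonneg _)

theorem exists_mem_testGraph (hV : Continuous V) (hφ : ContDiff ℝ ∞ φ)
    (hcφ : HasCompactSupport φ) : ∃ p ∈ testGraph V k, p.1 =ᵐ[volume] φ ∧
      p.2 =ᵐ[volume] fun x => -deriv (deriv φ) x + (k : ℂ) ^ 2 * (V x : ℂ) * φ x := by
  have h1 : MemLp φ 2 volume := hφ.continuous.memLp_of_hasCompactSupport hcφ
  have hc : Continuous fun x => -deriv (deriv φ) x + (k : ℂ) ^ 2 * (V x : ℂ) * φ x := by
    have := continuous_deriv_of_smooth (contDiff_deriv_of_smooth hφ)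
    have := hφ.continuous
    fun_prop
  have hcs : HasCompactSupport fun x => -deriv (deriv φ) x + (k : ℂ) ^ 2 * (V x : ℂ) * φ x :=
    (hcφ.deriv.deriv.comp_left (g := fun z => -z) neg_zero).add hcφ.mul_left
  have h2 : MemLp (fun x => -deriv (deriv φ) x + (k : ℂ) ^ 2 * (V x : ℂ) * φ x) 2 volume :=
    hc.memLp_of_hasCompactSupport hcs
  exact ⟨(h1.toLp, h2.toLp), ⟨φ, hφ, hcφ, h1.coeFn_toLp, h2.coeFn_toLp⟩, h1.coeFn_toLp,
    h2.coeFn_toLp⟩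

theorem dense_fst_testGraph (hV : Continuous V) :
    Dense {u : L2 | ∃ p ∈ testGraph V k, p.1 = u} := by
  refine (Lp.dense_hasCompactSupport_contDiff (F := ℂ) (μ := (volume : Measure ℝ)) (p := 2)
    (by simp)).mono ?_
  rintro u ⟨φ, hu, hcφ, hφ⟩
  obtain ⟨p, hp, hp1, -⟩ := exists_mem_testGraph (V := V) (k := k) hV hφ hcφ
  exact ⟨p, hp, Lp.ext (hp1.trans hu.symm)⟩

/-- Essential self-adjointness, in the form that `-∂ₓ² + k² V + 1` has dense range on the smooth
compactly supported functions: an `L²` function orthogonal to the range is a weak solution of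
`g'' = (k² V + 1) g`. -/
theorem dense_range_testGraph (hV : Continuous V) (hV0 : ∀ x, 0 ≤ V x) :
    Dense {f : L2 | ∃ p ∈ testGraph V k, p.1 + p.2 = f} := by
  let K : Submodule ℂ L2 := (testGraph V k).map (LinearMap.fst ℂ L2 L2 + LinearMap.snd ℂ L2 L2)
  have hK : {f : L2 | ∃ p ∈ testGraph V k, p.1 + p.2 = f} = (K : Set L2) := rfl
  rw [hK, Submodule.dense_iff_topologicalClosure_eq_top, Submodule.topologicalClosure_eq_top_iff,
    Submodule.eq_bot_iff]
  intro g hg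
  have hint : ∀ φ : ℝ → ℝ, ContDiff ℝ ∞ φ → HasCompactSupport φ →
      (Integrable fun x => g x * ((-deriv (deriv φ) x + (1 + (k : ℝ) ^ 2 * V x) * φ x : ℝ) : ℂ)) ∧
      ∫ x, g x * ((-deriv (deriv φ) x + (1 + (k : ℝ) ^ 2 * V x) * φ x : ℝ) : ℂ) = 0 := by
    intro φ hφ hcφ
    have hφc : ContDiff ℝ ∞ fun x => (φ x : ℂ) := Complex.ofRealCLM.contDiff.comp hφ
    have hcφc : HasCompactSupport fun x => (φ x : ℂ) := hcφ.comp_left Complex.ofReal_zero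
    have d1 : deriv (fun x => (φ x : ℂ)) = fun x => ((deriv φ x : ℝ) : ℂ) := funext fun x =>
      ((hφ.differentiable (by simp) x).hasDerivAt.ofReal_comp).deriv
    have d2 : deriv (deriv fun x => (φ x : ℂ)) = fun x => ((deriv (deriv φ) x : ℝ) : ℂ) := by
      rw [d1]
      exact funext fun x => (((contDiff_infty_iff_deriv.1 hφ).2.differentiable
        (by simp) x).hasDerivAt.ofReal_comp).deriv
    obtain ⟨p, hp, hp1, hp2⟩ := exists_mem_testGraph (V := V) (k := k) hV hφc hcφc
    have h0 : ⟪p.1 + p.2, g⟫_ℂ = 0 :=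
      (Submodule.mem_orthogonal _ _).1 hg _ (Submodule.mem_map_of_mem hp)
    have hae : (fun x => ⟪(p.1 + p.2 : L2) x, g x⟫_ℂ) =ᵐ[volume] fun x =>
        g x * ((-deriv (deriv φ) x + (1 + (k : ℝ) ^ 2 * V x) * φ x : ℝ) : ℂ) := by
      filter_upwards [Lp.coeFn_add p.1 p.2, hp1, hp2] with x hx hx1 hx2
      have e : (p.1 + p.2 : L2) x
          = ((-deriv (deriv φ) x + (1 + (k : ℝ) ^ 2 * V x) * φ x : ℝ) : ℂ) := by
        rw [hx, Pi.add_apply, hx1, hx2, d2]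
        push_cast
        ring
      rw [e, RCLike.inner_apply, Complex.conj_ofReal]
    refine ⟨(L2.integrable_inner _ _).congr hae, ?_⟩
    rw [← integral_congr_ae hae, ← L2.inner_def, h0]
  have hg2 : MemLp g 2 volume := Lp.memLp g
  have hq : Continuous fun x => 1 + (k : ℝ) ^ 2 * V x := by fun_prop
  have hq0 : ∀ x, 0 ≤ 1 + (k : ℝ) ^ 2 * V x := fun x => by
    have := hV0 x
    positivity
  have hre := ae_eq_zero_of_weak_solution hq hq0 hg2.re fun φ hφ hcφ => by
    obtain ⟨h1, h2⟩ := hint φ hφ hcφ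
    have h3 := Complex.reCLM.integral_comp_comm h1
    rw [h2, map_zero] at h3
    simpa only [Complex.reCLM_apply, Complex.re_mul_ofReal, RCLike.re_to_complex] using h3
  have him := ae_eq_zero_of_weak_solution hq hq0 hg2.im fun φ hφ hcφ => by
    obtain ⟨h1, h2⟩ := hint φ hφ hcφ
    have h3 := Complex.imCLM.integral_comp_comm h1
    rw [h2, map_zero] at h3
    simpa only [Complex.imCLM_apply, Complex.im_mul_ofReal, RCLike.im_to_complex] using h3
  refine Lp.ext ?_
  filter_upwards [hre, him, Lp.coeFn_zero ℂ 2 (volume : Measure ℝ)] with x h1 h2 h3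
  rw [h3]
  exact Complex.ext h1 h2

/-- The minimal operator is closable, being symmetric and densely defined, so the graph of
`schrodinger V k` is the closure of `testGraph V k`. -/
theorem schrodinger_graph (hV : Continuous V) :
    (schrodinger V k).graph = (testGraph V k).topologicalClosure := by
  have hcl : (minimalOperator V k).IsClosable := by
    refine ⟨(testGraph V k).topologicalClosure.toLinearPMap, ?_⟩
    rw [minimalOperator_graph, Submodule.toLinearPMap_graph_eq]
    intro p hp h0
    refine (dense_fst_testGraph (k := k) hV).eq_zero_of_inner_left ℂ ?_
    rintro u ⟨q, hq, rfl⟩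
    have := (isSymmetricGraph_testGraph (k := k) hV).topologicalClosure p hp q
      ((testGraph V k).le_topologicalClosure hq)
    rw [← this, h0, inner_zero_left]
  rw [schrodinger, ← hcl.graph_closure_eq_closure_graph, minimalOperator_graph]

theorem integral_mul_le_sqrt_mul_sqrt {f g : ℝ → ℝ} (hf : ∀ x, 0 ≤ f x) (hg : ∀ x, 0 ≤ g x)
    (hf2 : MemLp f 2) (hg2 : MemLp g 2) :
    ∫ x, f x * g x ≤ √(∫ x, f x ^ 2) * √(∫ x, g x ^ 2) := by
  have h := integral_mul_le_Lp_mul_Lq_of_nonneg (μ := (volume : Measure ℝ))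
    Real.HolderConjugate.two_two (ae_of_all _ hf) (ae_of_all _ hg)
    (by simpa using hf2) (by simpa using hg2)
  simpa [Real.sqrt_eq_rpow] using h

/-- The difference of the forms of two potentials is small relative to the two form norms. -/
theorem norm_form_sub_le {m : ℝ → ℝ} {δ : ℝ} (hδ : 0 ≤ δ) (hV : Continuous V)
    (hV' : Continuous V') (hm : ∀ x, 0 ≤ m x) (hmV : ∀ x, m x ≤ V x) (hmV' : ∀ x, m x ≤ V' x)
    (hsub : ∀ x, |V x - V' x| ≤ δ * m x) {p q : L2 × L2} (hp : p ∈ testGraph V k)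
    (hq : q ∈ testGraph V' k) :
    ‖⟪p.1, q.2⟫_ℂ - ⟪p.2, q.1⟫_ℂ‖ ≤ δ * ‖p.1 + p.2‖ * ‖q.1 + q.2‖ := by
  obtain ⟨φ, hφ, hcφ, hp1, hp2⟩ := hp
  obtain ⟨ψ, hψ, hcψ, hq1, hq2⟩ := hq
  have hV0 : ∀ x, 0 ≤ V x := fun x => (hm x).trans (hmV x)
  have hV0' : ∀ x, 0 ≤ V' x := fun x => (hm x).trans (hmV' x)
  have hEp := energy_le hV hV0 hφ hcφ hp1 hp2
  have hEq := energy_le hV' hV0' hψ hcψ hq1 hq2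
  rw [inner_eq_form hV' hφ hcφ hψ hp1 hq2, inner_eq_form' hV hφ hψ hcψ hp2 hq1, form, form,
    add_sub_add_left_eq_sub, ← integral_sub (integrable_potential_term hV' hφ hcφ hψ)
      (integrable_potential_term hV hφ hcφ hψ)]
  have hφc := hφ.continuous
  have hψc := hψ.continuous
  let f : ℝ → ℝ := fun x => |(k : ℝ)| * √(V x) * ‖φ x‖
  let g : ℝ → ℝ := fun x => |(k : ℝ)| * √(V' x) * ‖ψ x‖
  have hfc : Continuous f := by fun_prop
  have hgc : Continuous g := by fun_prop
  have hfs : HasCompactSupport f := hcφ.norm.mul_left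
  have hgs : HasCompactSupport g := hcψ.norm.mul_left
  have hf0 : ∀ x, 0 ≤ f x := fun x => by positivity
  have hg0 : ∀ x, 0 ≤ g x := fun x => by positivity
  have hf2 : ∀ x, f x ^ 2 = (k : ℝ) ^ 2 * V x * ‖φ x‖ ^ 2 := fun x => by
    simp only [f, mul_pow, sq_abs, Real.sq_sqrt (hV0 x)]
  have hg2 : ∀ x, g x ^ 2 = (k : ℝ) ^ 2 * V' x * ‖ψ x‖ ^ 2 := fun x => by
    simp only [g, mul_pow, sq_abs, Real.sq_sqrt (hV0' x)]
  have hmle : ∀ x, m x ≤ √(V x) * √(V' x) := fun x => by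
    rw [← Real.sqrt_mul (hV0 x)]
    refine Real.le_sqrt_of_sq_le ?_
    rw [sq]
    exact mul_le_mul (hmV x) (hmV' x) (hm x) (hV0 x)
  have h1 : ‖∫ x, ((((k : ℝ) ^ 2 * V' x : ℝ)) : ℂ) * (conj (φ x) * ψ x)
      - ((((k : ℝ) ^ 2 * V x : ℝ)) : ℂ) * (conj (φ x) * ψ x)‖ ≤ ∫ x, δ * (f x * g x) := by
    refine norm_integral_le_of_norm_le
      (((hfc.mul hgc).integrable_of_hasCompactSupport hfs.mul_right).const_mul δ)
      (ae_of_all _ fun x => ?_)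
    rw [← sub_mul, ← Complex.ofReal_sub, ← mul_sub, norm_mul, norm_mul, Complex.norm_real,
      Complex.norm_conj, Real.norm_eq_abs, abs_mul, abs_sub_comm, abs_of_nonneg (sq_nonneg (k : ℝ))]
    calc (k : ℝ) ^ 2 * |V x - V' x| * (‖φ x‖ * ‖ψ x‖)
        ≤ (k : ℝ) ^ 2 * (δ * (√(V x) * √(V' x))) * (‖φ x‖ * ‖ψ x‖) := by
          gcongr
          exact (hsub x).trans (mul_le_mul_of_nonneg_left (hmle x) hδ)
      _ = δ * (f x * g x) := by
          simp only [f, g]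
          rw [← sq_abs (k : ℝ)]
          ring
  refine h1.trans ?_
  rw [integral_const_mul, mul_assoc]
  refine mul_le_mul_of_nonneg_left ?_ hδ
  refine (integral_mul_le_sqrt_mul_sqrt hf0 hg0 (hfc.memLp_of_hasCompactSupport hfs)
    (hgc.memLp_of_hasCompactSupport hgs)).trans ?_
  refine mul_le_mul (Real.sqrt_le_iff.2 ⟨norm_nonneg _, ?_⟩)
    (Real.sqrt_le_iff.2 ⟨norm_nonneg _, ?_⟩) (Real.sqrt_nonneg _) (norm_nonneg _)
  · simp only [hf2]
    exact le_trans (le_add_of_nonneg_left (integral_nonneg fun x => by positivity)) hEp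
  · simp only [hg2]
    exact le_trans (le_add_of_nonneg_left (integral_nonneg fun x => by positivity)) hEq

end Form

/-! ### Compactness of the resolvent -/

section Compactness

open Filter Topology Set
open scoped InnerProductSpace ComplexConjugate

/-- The integral over a sliding window is a convolution, so its integral over the line is a
product. -/
theorem integrable_and_integral_window {g : ℝ → ℝ} (hg : Integrable g) {h : ℝ} (hh : 0 < h) :
    (Integrable fun x => ∫ t in (0 : ℝ)..h, g (x - t)) ∧
      ∫ x, ∫ t in (0 : ℝ)..h, g (x - t) = h * ∫ x, g x := by
  have hf : Integrable ((Ioc (0 : ℝ) h).indicator fun _ => (1 : ℝ)) :=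
    (integrable_indicator_iff measurableSet_Ioc).2 (by simp)
  have hf1 : ∫ x, (Ioc (0 : ℝ) h).indicator (fun _ => (1 : ℝ)) x = h := by
    rw [integral_indicator measurableSet_Ioc]
    simp [hh.le]
  have e : (fun x => ∫ t in (0 : ℝ)..h, g (x - t)) = convolution
      ((Ioc (0 : ℝ) h).indicator fun _ => (1 : ℝ)) g (ContinuousLinearMap.mul ℝ ℝ) volume := by
    funext x
    rw [convolution_mul, intervalIntegral.integral_of_le hh.le,
      ← integral_indicator measurableSet_Ioc]
    refine integral_congr_ae (ae_of_all _ fun t => ?_)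
    by_cases ht : t ∈ Ioc (0 : ℝ) h <;> simp [ht]
  rw [e]
  refine ⟨hf.integrable_convolution _ hg, ?_⟩
  rw [integral_convolution _ hf hg, hf1]
  rfl

theorem sq_integral_le {g : ℝ → ℝ} (hg : Continuous g) {h : ℝ} (hh : 0 < h) :
    (∫ t in (0 : ℝ)..h, g t) ^ 2 ≤ h * ∫ t in (0 : ℝ)..h, g t ^ 2 := by
  set I := ∫ t in (0 : ℝ)..h, g t with hI
  have hi : ∀ f : ℝ → ℝ, Continuous f → IntervalIntegrable f volume 0 h :=
    fun f hf => hf.intervalIntegrable _ _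
  -- Integrate `0 ≤ (h g - I) ^ 2`.
  have h0 : 0 ≤ ∫ t in (0 : ℝ)..h, (h * g t - I) ^ 2 :=
    intervalIntegral.integral_nonneg hh.le fun t _ => sq_nonneg _
  have e : ∀ t, (h * g t - I) ^ 2 = h ^ 2 * g t ^ 2 - 2 * h * I * g t + I ^ 2 :=
    fun t => by ring
  simp only [e] at h0
  rw [intervalIntegral.integral_add (hi _ (by fun_prop)) (hi _ (by fun_prop)),
    intervalIntegral.integral_sub (hi _ (by fun_prop)) (hi _ (by fun_prop)),
    intervalIntegral.integral_const_mul, intervalIntegral.integral_const_mul,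
    intervalIntegral.integral_const, smul_eq_mul, ← hI] at h0
  have h1 : 0 ≤ h * (h * (∫ t in (0 : ℝ)..h, g t ^ 2) - I ^ 2) := by
    linarith
  linarith [nonneg_of_mul_nonneg_right h1 hh]

/-- The Cauchy-Schwarz bound for the oscillation of `φ` on a cell, with a window of integration
that depends only on `x` and not on the cell. -/
theorem norm_sub_sq_le_window {φ : ℝ → ℂ} (hφ : ContDiff ℝ ∞ φ) {h a x : ℝ} (hh : 0 < h)
    (hax : a ≤ x) (hxa : x - h ≤ a) :
    ‖φ x - φ a‖ ^ 2 ≤ h * ∫ t in (0 : ℝ)..h, ‖deriv φ (x - t)‖ ^ 2 := by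
  have hd := continuous_deriv_of_smooth hφ
  have h1 : φ x - φ a = ∫ y in a..x, deriv φ y :=
    (intervalIntegral.integral_deriv_eq_sub (fun y _ => hφ.differentiable (by simp) y)
      (hd.intervalIntegrable _ _)).symm
  have h2 : ‖φ x - φ a‖ ≤ ∫ y in (x - h)..x, ‖deriv φ y‖ := by
    rw [h1]
    refine (intervalIntegral.norm_integral_le_integral_norm hax).trans ?_
    exact intervalIntegral.integral_mono_interval hxa hax le_rfl
      (ae_of_all _ fun y => norm_nonneg _) (hd.norm.intervalIntegrable _ _)
  have h3 : ∫ y in (x - h)..x, ‖deriv φ y‖ = ∫ t in (0 : ℝ)..h, ‖deriv φ (x - t)‖ := by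
    rw [intervalIntegral.integral_comp_sub_left (fun y => ‖deriv φ y‖) x, sub_zero]
  rw [h3] at h2
  refine (pow_le_pow_left₀ (norm_nonneg _) h2 2).trans ?_
  exact sq_integral_le (g := fun t => ‖deriv φ (x - t)‖) (by fun_prop) hh

theorem L2_norm_sq (f : L2) : ‖f‖ ^ 2 = ∫ x, ‖f x‖ ^ 2 := by
  have h := inner_self_eq_norm_sq_to_K (𝕜 := ℂ) f
  rw [L2.inner_def] at h
  simp only [inner_self_eq_norm_sq_to_K, Complex.coe_algebraMap, ← Complex.ofReal_pow,
    integral_complex_ofReal] at h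
  exact (Complex.ofReal_injective h).symm

/-- The indicator function of `[j h, (j + 1) h)` in `L²`. -/
noncomputable def cellIndicator (h : ℝ) (j : ℤ) : L2 :=
  indicatorConstLp 2 (measurableSet_Ico (a := (j : ℝ) * h) (b := (j + 1 : ℝ) * h))
    measure_Ico_lt_top.ne (1 : ℂ)

theorem mem_cell_iff {h : ℝ} (hh : 0 < h) (j : ℤ) (x : ℝ) :
    x ∈ Ico ((j : ℝ) * h) ((j + 1 : ℝ) * h) ↔ ⌊x / h⌋ = j := by
  rw [Int.floor_eq_iff, le_div_iff₀ hh, div_lt_iff₀ hh, mem_Ico]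

theorem not_finiteDimensional_L2 : ¬ FiniteDimensional ℂ L2 := by
  intro hfin
  have hon : Orthonormal ℂ fun j : ℤ => cellIndicator 1 j := by
    rw [orthonormal_iff_ite]
    intro i j
    rw [cellIndicator, cellIndicator,
      L2.inner_indicatorConstLp_one_indicatorConstLp_one measurableSet_Ico measurableSet_Ico
      measure_Ico_lt_top.ne measure_Ico_lt_top.ne]
    split_ifs with hij
    · subst hij
      simp
    · have : Ico ((i : ℝ) * 1) ((i + 1 : ℝ) * 1) ∩ Ico ((j : ℝ) * 1) ((j + 1 : ℝ) * 1) = ∅ := by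
        rw [Set.eq_empty_iff_forall_notMem]
        rintro x ⟨h1, h2⟩
        exact hij (((mem_cell_iff one_pos i x).1 h1).symm.trans ((mem_cell_iff one_pos j x).1 h2))
      rw [this]
      simp
  have := hon.linearIndependent.finite
  exact not_finite ℤ

/-- Functions of bounded energy are approximated in `L²`, uniformly, by step functions: the
derivative controls the oscillation on cells of length `ε`, and the potential controls the tail. -/
theorem exists_finiteDimensional_approx {V : ℝ → ℝ} {k : ℤ} (hk : k ≠ 0) (hV : Continuous V)
    (hV0 : ∀ x, 0 ≤ V x) (hVlim : Tendsto V (cocompact ℝ) atTop) {ε : ℝ} (hε : 0 < ε) :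
    ∃ S : Submodule ℂ L2, FiniteDimensional ℂ S ∧
      ∀ p ∈ testGraph V k, ∃ s ∈ S, ‖p.1 - s‖ ≤ ε * ‖p.1 + p.2‖ := by
  classical
  obtain ⟨M, hM⟩ : ∃ M : ℕ, ∀ x, M * ε ≤ |x| → (ε ^ 2)⁻¹ ≤ V x := by
    have h1 := hVlim.eventually (eventually_ge_atTop (ε ^ 2)⁻¹)
    rw [← Metric.cobounded_eq_cocompact,
      (Metric.hasBasis_cobounded_compl_closedBall (0 : ℝ)).eventually_iff] at h1
    obtain ⟨R, -, hR⟩ := h1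
    obtain ⟨M, hMR⟩ := exists_nat_gt (R / ε)
    refine ⟨M, fun x hx => hR ?_⟩
    rw [div_lt_iff₀ hε] at hMR
    simp only [mem_compl_iff, Metric.mem_closedBall, dist_zero_right, Real.norm_eq_abs, not_le]
    linarith
  let J : Finset ℤ := Finset.Ico (-(M : ℤ)) M
  refine ⟨Submodule.span ℂ (J.image (cellIndicator ε) : Set L2), inferInstance, ?_⟩
  rintro p ⟨φ, hφ, hcφ, hp1, hp2⟩
  refine ⟨∑ j ∈ J, φ (j * ε) • cellIndicator ε j, Submodule.sum_mem _ fun j hj =>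
    Submodule.smul_mem _ _ (Submodule.subset_span (Finset.mem_coe.2
      (Finset.mem_image_of_mem _ hj))), ?_⟩
  have hstep : (∑ j ∈ J, φ (j * ε) • cellIndicator ε j : L2) =ᵐ[volume]
      fun x => if ⌊x / ε⌋ ∈ J then φ (⌊x / ε⌋ * ε) else 0 := by
    have h1 : ∀ j : ℤ, (φ (j * ε) • cellIndicator ε j : L2) =ᵐ[volume]
        fun x => if ⌊x / ε⌋ = j then φ (j * ε) else 0 := fun j => by
      filter_upwards [Lp.coeFn_smul (φ (j * ε)) (cellIndicator ε j),
        indicatorConstLp_coeFn (p := 2) (μ := (volume : Measure ℝ))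
          (hs := measurableSet_Ico (a := (j : ℝ) * ε) (b := (j + 1 : ℝ) * ε))
          (hμs := measure_Ico_lt_top.ne) (c := (1 : ℂ))] with x h1 h2
      rw [h1, Pi.smul_apply, cellIndicator, h2, Set.indicator_apply]
      simp only [mem_cell_iff hε, smul_eq_mul, mul_ite, mul_one, mul_zero]
    have h2 : ∀ᵐ x, ∀ j : ℤ, (φ (j * ε) • cellIndicator ε j : L2) x
        = if ⌊x / ε⌋ = j then φ (j * ε) else 0 := ae_all_iff.2 h1
    filter_upwards [h2, Lp.coeFn_fun_finsetSum J fun j : ℤ => φ (j * ε) • cellIndicator ε j]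
      with x hx hsum
    rw [hsum, Finset.sum_congr rfl fun j _ => hx j, Finset.sum_ite_eq]
  have hd := continuous_deriv_of_smooth hφ
  have hφc := hφ.continuous
  have hgi : Integrable fun x => ‖deriv φ x‖ ^ 2 :=
    (by fun_prop : Continuous fun x => ‖deriv φ x‖ ^ 2).integrable_of_hasCompactSupport
      (hcφ.deriv.norm.comp_left (g := fun y => y ^ 2) (by simp))
  obtain ⟨hwi, hw⟩ := integrable_and_integral_window hgi hε
  have hvi : Integrable fun x => (k : ℝ) ^ 2 * V x * ‖φ x‖ ^ 2 :=
    (by fun_prop : Continuous fun x => (k : ℝ) ^ 2 * V x * ‖φ x‖ ^ 2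
      ).integrable_of_hasCompactSupport
        (hcφ.norm.comp_left (g := fun y => y ^ 2) (by simp)).mul_left
  have hk1 : (1 : ℝ) ≤ (k : ℝ) ^ 2 := by
    have : (0 : ℤ) < k ^ 2 := by positivity
    have : (1 : ℤ) ≤ k ^ 2 := this
    exact_mod_cast this
  have hbound : ∀ x, ‖φ x - if ⌊x / ε⌋ ∈ J then φ (⌊x / ε⌋ * ε) else 0‖ ^ 2 ≤
      ε * (∫ t in (0 : ℝ)..ε, ‖deriv φ (x - t)‖ ^ 2) + ε ^ 2 * ((k : ℝ) ^ 2 * V x * ‖φ x‖ ^ 2) := by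
    intro x
    have hw0 : 0 ≤ ∫ t in (0 : ℝ)..ε, ‖deriv φ (x - t)‖ ^ 2 :=
      intervalIntegral.integral_nonneg hε.le fun t _ => by positivity
    have hVx := hV0 x
    obtain ⟨h1, h2⟩ := (mem_cell_iff hε ⌊x / ε⌋ x).2 rfl
    split_ifs with hJ
    · refine (norm_sub_sq_le_window hφ hε h1 (by linarith)).trans ?_
      exact le_add_of_nonneg_right (by positivity)
    · have hx : M * ε ≤ |x| := by
        by_contra! hlt
        obtain ⟨h3, h4⟩ := abs_lt.1 hlt
        refine hJ (Finset.mem_Ico.2 ⟨Int.le_floor.2 ?_, Int.floor_lt.2 ?_⟩)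
        · rw [le_div_iff₀ hε]
          push_cast
          linarith
        · rw [div_lt_iff₀ hε]
          exact_mod_cast h4
      have h3 : 1 ≤ ε ^ 2 * ((k : ℝ) ^ 2 * V x) := by
        have h4 : (ε ^ 2)⁻¹ ≤ (k : ℝ) ^ 2 * V x :=
          (hM x hx).trans (le_mul_of_one_le_left hVx hk1)
        rwa [inv_le_iff_one_le_mul₀' (by positivity)] at h4
      rw [sub_zero]
      refine le_add_of_nonneg_of_le (by positivity) ?_
      rw [← mul_assoc]
      exact le_mul_of_one_le_left (by positivity) h3
  have hE := energy_le (k := k) hV hV0 hφ hcφ hp1 hp2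
  -- The cells have length `ε`, and outside the `2 M` cells around `0` the potential is at least
  -- `ε⁻²`, so both parts of the energy enter with the factor `ε²`.
  refine le_of_sq_le_sq ?_ (by positivity)
  rw [L2_norm_sq, mul_pow]
  calc ∫ x, ‖(p.1 - ∑ j ∈ J, φ (j * ε) • cellIndicator ε j : L2) x‖ ^ 2
      ≤ ∫ x, (ε * (∫ t in (0 : ℝ)..ε, ‖deriv φ (x - t)‖ ^ 2)
          + ε ^ 2 * ((k : ℝ) ^ 2 * V x * ‖φ x‖ ^ 2)) := by
        refine integral_mono_of_nonneg (ae_of_all _ fun x => by positivity)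
          ((hwi.const_mul _).add (hvi.const_mul _)) ?_
        filter_upwards [hp1, hstep, Lp.coeFn_sub p.1 (∑ j ∈ J, φ (j * ε) • cellIndicator ε j)]
          with x h1 h2 h3
        rw [h3, Pi.sub_apply, h1, h2]
        exact hbound x
    _ = ε ^ 2 * ((∫ x, ‖deriv φ x‖ ^ 2) + ∫ x, (k : ℝ) ^ 2 * V x * ‖φ x‖ ^ 2) := by
        rw [integral_add (hwi.const_mul _) (hvi.const_mul _), integral_const_mul,
          integral_const_mul, hw]
        ring
    _ ≤ ε ^ 2 * ‖p.1 + p.2‖ ^ 2 := by gcongr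

end Compactness

/-! ### Potentials with weight `|x|^(2γ)` -/

section Potentials

open Filter Topology

variable {γ : ℝ}

theorem continuous_of_mem_potentials (hγ : 0 < γ) {V : WeightedSpace γ} (hV : V ∈ potentials γ) :
    Continuous (V : ℝ → ℝ) := by
  obtain ⟨W, -, hW⟩ := hV
  have e : (V : ℝ → ℝ) = fun x => |x| ^ (2 * γ) * W x := funext hW
  rw [e]
  exact (continuous_abs.rpow_const fun x => Or.inr (by positivity)).mul W.continuous

theorem weight_le_of_mem_potentials {V : WeightedSpace γ} (hV : V ∈ potentials γ) (x : ℝ) :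
    |x| ^ (2 * γ) ≤ V x := by
  obtain ⟨W, hW1, hW⟩ := hV
  rw [hW]
  exact le_mul_of_one_le_right (by positivity) (hW1 x)

theorem abs_sub_le_norm_mul_weight (V V' : WeightedSpace γ) (x : ℝ) :
    |V x - V' x| ≤ ‖V - V'‖ * |x| ^ (2 * γ) := by
  obtain ⟨W, hW⟩ := (weightEquiv γ).surjective (V - V')
  have h1 : V x - V' x = |x| ^ (2 * γ) * W x := by
    rw [← weightEquiv_apply, hW]
    rfl
  rw [h1, ← hW, norm_weightEquiv, abs_mul, abs_of_nonneg (by positivity), mul_comm]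
  gcongr
  exact W.norm_coe_le_norm x

theorem tendsto_of_mem_potentials (hγ : 0 < γ) {V : WeightedSpace γ} (hV : V ∈ potentials γ) :
    Tendsto (V : ℝ → ℝ) (cocompact ℝ) atTop := by
  refine tendsto_atTop_mono (weight_le_of_mem_potentials hV) ?_
  exact (tendsto_rpow_atTop (by positivity)).comp (tendsto_norm_cocompact_atTop (E := ℝ))

end Potentials

/-- The resolvents are Lipschitz in the potential, so the openness of disjointness of their first
eigenvalues applies to them. -/
theorem isOpen_goodSet {γ : ℝ} (hγ : 0 < γ) (n : ℕ) {k l : ℤ} (hk : k ≠ 0) (hl : l ≠ 0) :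
    IsOpen (goodSet γ k l n) := by
  have hc : ∀ V : ↥(potentials γ), Continuous (V.1 : ℝ → ℝ) :=
    fun V => continuous_of_mem_potentials hγ V.2
  have h0 : ∀ (V : ↥(potentials γ)) x, 0 ≤ V.1 x :=
    fun V x => le_trans (by positivity) (weight_le_of_mem_potentials V.2 x)
  choose R hR using fun (k : ℤ) (V : ↥(potentials γ)) =>
    exists_isResolvent (isNonnegGraph_testGraph (k := k) (hc V) (h0 V))
      (dense_range_testGraph (hc V) (h0 V))
  have hRs : ∀ k V, (R k V : L2 →ₗ[ℂ] L2).IsSymmetric := fun k V =>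
    (hR k V).isSymmetric (isSymmetricGraph_testGraph (hc V)).topologicalClosure
  have hRc : ∀ k ≠ 0, ∀ V, IsCompactOperator (R k V) := fun k hk V =>
    (hR k V).isCompactOperator (dense_range_testGraph (hc V) (h0 V)) fun ε hε =>
      exists_finiteDimensional_approx hk (hc V) (h0 V) (tendsto_of_mem_potentials hγ V.2) hε
  have hRcont : ∀ k, Continuous (R k) := fun k => by
    refine (LipschitzWith.of_dist_le_mul (K := 1) fun V V' => ?_).continuous
    rw [NNReal.coe_one, one_mul, dist_eq_norm, Subtype.dist_eq, dist_eq_norm]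
    exact (hR k V).norm_sub_le (hR k V') (isSymmetricGraph_testGraph (hc V')) (norm_nonneg _)
      fun p hp q hq => norm_form_sub_le (norm_nonneg _) (hc V) (hc V') (fun x => by positivity)
        (weight_le_of_mem_potentials V.2) (weight_le_of_mem_potentials V'.2)
        (abs_sub_le_norm_mul_weight V.1 V'.1) hp hq
  have hset : goodSet γ k l n =
      {V | topEigenvalues (R k V) n ∩ topEigenvalues (R l V) n = ∅} := by
    ext V
    have hg := schrodinger_graph (k := k) (hc V)
    have hg' := schrodinger_graph (k := l) (hc V)
    exact firstEigenvalues_inter_eq_empty_iff (by rw [hg]; exact hR k V)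
      (by rw [hg]; exact (isNonnegGraph_testGraph (hc V) (h0 V)).topologicalClosure)
      (by rw [hg']; exact hR l V)
      (by rw [hg']; exact (isNonnegGraph_testGraph (hc V) (h0 V)).topologicalClosure) n
  rw [hset]
  refine isOpen_topEigenvalues_disjoint not_finiteDimensional_L2 (hRcont k) (hRcont l)
    (hRc k hk) (hRc l hl) (hRs k) (hRs l) (fun V u => ?_) (fun V u hu => ?_) n
  · exact (hR k V).re_inner_nonneg
      (isNonnegGraph_testGraph (hc V) (h0 V)).topologicalClosure u
  · refine (hR k V).eq_zero_of_apply_eq_zero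
      (isSymmetricGraph_testGraph (hc V)).topologicalClosure ?_ hu
    refine (dense_fst_testGraph (k := k) (hc V)).mono ?_
    rintro w ⟨p, hp, rfl⟩
    exact ⟨p, (testGraph V.1 k).le_topologicalClosure hp, rfl⟩

end Grushin

theorem mainTheorem4 (γ : ℝ) (hγ : 0 < γ) (n : ℕ) (k l : ℤ) (hk : k ≠ 0) (hl : l ≠ 0)
    (hkl : k ^ 2 ≠ l ^ 2) :
    IsOpen (Grushin.goodSet γ k l n) :=
  Grushin.isOpen_goodSet hγ n hk hl
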